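/- **Setting.** Let $\boldsymbol\Sigma\in\mathbb R^{d\times d}$ be a diagonal positive semidefinite matrix, $\mathbf w^\star\in\mathbb R^d\setminus\{0\}$ with $\|\mathbf w^\star\|_0\le s$, $\sigma>0$, and let $\mathsf P$ be the law of $(\mathbf x,y)$ with $\mathbf x\sim\mathsf N(0,\boldsymbol\Sigma)$, $y=\langle\mathbf w^\star,\mathbf x\rangle+\epsilon$, where $\epsilon\sim\mathsf N(0,\sigma^2)$ is independent of $\mathbf x$. Let $(\mathbf x_1,y_1),\dots,(\mathbf x_n,y_n)$ be i.i.d. from $\mathsf P$. Put $\hat r_j=\frac1n\sum_{i=1}^n x_{ij}y_i$, $\hat{\mathbf R}=\mathrm{diag}(\hat r_1,\dots,\hat r_d)$, $\tilde{\mathbf x}_i=\hat{\mathbf R}\mathbf x_i$, and let $\tilde{\mathbf w}^t_{\mathsf{gd}}$ be the $t$-th iterate of gradient descent with step size $\eta$, started at $0$, on $\frac1{2n}\sum_{i=1}^n(y_i-\langle\mathbf w,\tilde{\mathbf x}_i\rangle)^2$. With $\hat{\mathbf R}$ fixed, let $\tilde L(\mathbf w)=\frac12\mathbb E_{(\mathbf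 x,y)\sim\mathsf P}[(\langle\hat{\mathbf R}\mathbf x,\mathbf w\rangle-y)^2]$ and $\mathcal E(\mathbf w)=\tilde L(\mathbf w)-\min_{\mathbf v}\tilde L(\mathbf v)$. Let $\mathcal S=\{i:w^\star_i\ne0\}$, $r_j=\sum_{i=1}^d w^\star_i\Sigma_{ij}$, $\mathbf R=\mathrm{diag}(r_1,\dots,r_d)$, and $$A=\frac{\sigma^2\,\mathrm{Tr}(\mathbf R\boldsymbol\Sigma\mathbf R)\log(d/\delta)}{n}+\frac{\sigma^2 s\,\mathrm{Tr}(\boldsymbol\Sigma)\log^2(d/\delta)}{n^2}.$$ **Theorem.** There are absolute constants $k\in\mathbb N$ and $c>0$ such that for every $B>0$ there is $C=C(B)>0$ such that for all $0<c_1\le c_2$ there is $K=K(B,c_1,c_2)>0$ for which the following holds, for all $d,n,s,\boldsymbol\Sigma,\mathbf w^\star$ as above, all $t\ge2$ and all $\delta\in(0,1)$ with $d/\delta\ge2$. Suppose that $\beta>0$ satisfies $\min_{i\in\mathcal S}|r_i|\ge\beta$, that $\|\mathbf R\|_2,\|\boldsymbol\Sigma\|_2,\|\mathbf w^\star\|_2,\sigma,\eta\le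 B$, that $$n\ \ge\ C\cdot\frac{1}{\beta^2}\,t^2 s\,\bigl(\mathrm{Tr}(\boldsymbol\Sigma)^{2/3}+\mathrm{Tr}(\mathbf R\boldsymbol\Sigma\mathbf R)\bigr)\log^k(d/\delta),$$ that $\eta\le c/\|\mathbf R\boldsymbol\Sigma\mathbf R\|_2$, and that $c_1\,\frac1\beta A^{-1/2}\le\eta t\le c_2\,\frac1\beta A^{-1/2}$. Then, with probability at least $1-\delta$, $$\mathcal E(\tilde{\mathbf w}^t_{\mathsf{gd}})\ \le\ K\,\frac{\log t}{\beta}\,\sqrt{A}.$$ -/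

import Mathlib

open MeasureTheory ProbabilityTheory
open scoped Matrix Matrix.Norms.L2Operator

noncomputable section

namespace SparseRegression

/-- The sparse linear model: the law of `(x, y)` with `x ∼ N(0, Cov)` and
`y = ⟨w, x⟩ + ε`, where `ε ∼ N(0, σ²)` is independent of `x`. -/
def linModel {d : ℕ} (Cov : Matrix (Fin d) (Fin d) ℝ) (w : EuclideanSpace ℝ (Fin d)) (σ : ℝ) :
    Measure (EuclideanSpace ℝ (Fin d) × ℝ) :=
  ((multivariateGaussian 0 Cov).prod (gaussianReal 0 (σ ^ 2).toNNReal)).map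
    (fun p => (p.1, inner ℝ w p.1 + p.2))

/-- The support `{i : w i ≠ 0}` of the ground truth. -/
def supp {d : ℕ} (w : EuclideanSpace ℝ (Fin d)) : Finset (Fin d) :=
  Finset.univ.filter (fun i => w i ≠ 0)

/-- The population correlations `r j = ∑ i, w i * Cov i j`. -/
def corr {d : ℕ} (Cov : Matrix (Fin d) (Fin d) ℝ) (w : EuclideanSpace ℝ (Fin d)) (j : Fin d) : ℝ :=
  ∑ i, w i * Cov i j

/-- `R = diag (r 1, …, r d)`. -/
def corrMatrix {d : ℕ} (Cov : Matrix (Fin d) (Fin d) ℝ) (w : EuclideanSpace ℝ (Fin d)) :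
    Matrix (Fin d) (Fin d) ℝ :=
  Matrix.diagonal (corr Cov w)

/-- The empirical correlations `(1/n) ∑ i, x i j * y i` of a data set. -/
def empCorr {n d : ℕ} (D : Fin n → EuclideanSpace ℝ (Fin d) × ℝ) (j : Fin d) : ℝ :=
  (1 / (n : ℝ)) * ∑ i, (D i).1 j * (D i).2

/-- The diagonal matrix of the empirical correlations. -/
def empCorrMatrix {n d : ℕ} (D : Fin n → EuclideanSpace ℝ (Fin d) × ℝ) :
    Matrix (Fin d) (Fin d) ℝ :=
  Matrix.diagonal (empCorr D)

/-- The linear reweighting `x ↦ A x` of a feature vector. -/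
def reweight {d : ℕ} (A : Matrix (Fin d) (Fin d) ℝ) (x : EuclideanSpace ℝ (Fin d)) :
    EuclideanSpace ℝ (Fin d) :=
  WithLp.toLp 2 (A *ᵥ x.ofLp)

/-- The preprocessing algorithm: every feature vector of the data set is multiplied by the diagonal
matrix of the empirical correlations; the labels are kept. -/
def preprocess {n d : ℕ} (D : Fin n → EuclideanSpace ℝ (Fin d) × ℝ) :
    Fin n → EuclideanSpace ℝ (Fin d) × ℝ :=
  fun i => (reweight (empCorrMatrix D) (D i).1, (D i).2)

/-- The least-squares training loss `(1/(2n)) ∑ i, (y i - ⟨v, x i⟩)²`. -/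
def trainLoss {n d : ℕ} (D : Fin n → EuclideanSpace ℝ (Fin d) × ℝ)
    (v : EuclideanSpace ℝ (Fin d)) : ℝ :=
  (1 / (2 * (n : ℝ))) * ∑ i, ((D i).2 - inner ℝ v (D i).1) ^ 2

/-- Gradient descent on the training loss, started at `0`, with step size `η`. -/
def gd {n d : ℕ} (D : Fin n → EuclideanSpace ℝ (Fin d) × ℝ) (η : ℝ) :
    ℕ → EuclideanSpace ℝ (Fin d)
  | 0 => 0
  | t + 1 => gd D η t - η • gradient (trainLoss D) (gd D η t)

/-- The population risk `(1/2) E_{(x,y) ∼ P} (⟨A x, v⟩ - y)²` of the predictor `x ↦ ⟨A x, v⟩`. -/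
def risk {d : ℕ} (P : Measure (EuclideanSpace ℝ (Fin d) × ℝ)) (A : Matrix (Fin d) (Fin d) ℝ)
    (v : EuclideanSpace ℝ (Fin d)) : ℝ :=
  (1 / 2) * ∫ p, (inner ℝ (reweight A p.1) v - p.2) ^ 2 ∂P

/-- The excess risk: the risk of `v` minus the smallest risk of a parameter, for the same `A`. -/
def excessRisk {d : ℕ} (P : Measure (EuclideanSpace ℝ (Fin d) × ℝ))
    (A : Matrix (Fin d) (Fin d) ℝ) (v : EuclideanSpace ℝ (Fin d)) : ℝ :=
  risk P A v - ⨅ u, risk P A u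

/-- The quantity `σ² Tr(RΣR) log(d/δ) / n + σ² s Tr(Σ) log²(d/δ) / n²`. -/
def noiseLevel {d : ℕ} (Cov : Matrix (Fin d) (Fin d) ℝ) (w : EuclideanSpace ℝ (Fin d))
    (σ δ : ℝ) (s n : ℕ) : ℝ :=
  σ ^ 2 * (corrMatrix Cov w * Cov * corrMatrix Cov w).trace * Real.log (d / δ) / n
    + σ ^ 2 * s * Cov.trace * Real.log (d / δ) ^ 2 / (n : ℝ) ^ 2

end SparseRegression

end

open SparseRegression

namespace SparseRegression

/-! ### Exponential moments and Chernoff bounds for empirical means -/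

section Concentration

/-! No matrix concentration is needed: entrywise control of the sample moments suffices. With `ρ =
√(log (d/δ) / n)`, a union bound (`prob_ge_of_goodSample`) gives `GoodSample`: every second moment
of features deviates by at most a constant times `√(Σ_jj Σ_kk) ρ`, and every feature-noise
correlation by a constant times `√Σ_jj σ ρ`. Everything after that is deterministic.

Write `r̂` for the empirical correlations. Sparsity gives `(r̂_j - r_j)² ≲ s ρ² Σ_jj`. Hence `|r̂_j|
≥ β/2` on the support, and the vector `target` with entries `w_j / r̂_j` has norm `O(1/β)` and
reproduces the true predictor. The excess risk is thus at most half the population quadratic form of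
the error `e = gd - target`.

The error obeys `e ↦ e - η (H e - ξ)`, where `H` is the empirical second-moment operator of the
reweighted features and `ξ` is pure noise with `‖ξ‖ ≲ √A`. Since `η H ≤ 1`, one has `‖e_t‖ ≤ ‖e_0‖ +
η t ‖ξ‖` and `⟪H e_t, e_t⟫ ≤ ‖e_0‖² / (η t) + 2 ‖ξ‖ ‖e_t‖`. Passing from `H` to its population
version costs `48 ρ Tr(R̂ΣR̂) ‖e_t‖²`; reweighting makes this trace small, and the sample size
brings the cost below `‖e_t‖² / (4Bt)`. With `η t` of order `1 / (β √A)`, each term is `O(√A / β)`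
(`tuned_error_le`). -/

lemma integrable_exp_sq_gaussianReal :
    Integrable (fun x : ℝ => Real.exp (x ^ 2 / 4)) (gaussianReal 0 1) ∧
      ∫ x, Real.exp (x ^ 2 / 4) ∂(gaussianReal 0 1) = √2 := by
  have key : ∀ x : ℝ, gaussianPDFReal 0 1 x • Real.exp (x ^ 2 / 4)
      = (√(2 * Real.pi))⁻¹ * Real.exp (-(1 / 4) * x ^ 2) := by
    intro x
    simp only [gaussianPDFReal, NNReal.coe_one, mul_one, sub_zero, smul_eq_mul]
    rw [mul_assoc, ← Real.exp_add]
    congr 2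
    ring
  constructor
  · rw [gaussianReal_of_var_ne_zero 0 one_ne_zero,
      integrable_withDensity_iff_integrable_smul' (measurable_gaussianPDF 0 1)
        (Filter.Eventually.of_forall fun x => gaussianPDF_lt_top)]
    simp only [toReal_gaussianPDF]
    rw [integrable_congr (Filter.Eventually.of_forall key)]
    exact (integrable_exp_neg_mul_sq (by norm_num)).const_mul _
  · rw [integral_gaussianReal_eq_integral_smul one_ne_zero]
    simp only [key]
    rw [integral_const_mul, integral_gaussian, ← Real.sqrt_inv, ← Real.sqrt_mul (by positivity)]
    congr 1
    field_simp
    norm_num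

variable {Ω : Type*} [MeasurableSpace Ω] {μ : Measure Ω} [IsProbabilityMeasure μ]

/-- Second-order Taylor expansion. The linear term is kept exactly so that it integrates to zero for
a centred variable; half of `exp |y|` absorbs `y²`, the other half the exponential in the remainder.
-/
lemma exp_mul_le_of_abs_le_half {y θ : ℝ} (hθ : |θ| ≤ 1 / 2) :
    Real.exp (θ * y) ≤ 1 + θ * y + 4 * θ ^ 2 * Real.exp |y| := by
  have h1 : Real.exp (θ * y) ≤ 1 + θ * y + (θ * y) ^ 2 * Real.exp |θ * y| := by
    have h := Complex.norm_exp_sub_sum_le_norm_mul_exp ((θ * y : ℝ) : ℂ) 2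
    rw [Finset.sum_range_succ, Finset.sum_range_one] at h
    have e : Complex.exp ((θ * y : ℝ) : ℂ) - (((θ * y : ℝ) : ℂ) ^ 0 / (Nat.factorial 0 : ℂ)
        + ((θ * y : ℝ) : ℂ) ^ 1 / (Nat.factorial 1 : ℂ))
        = ((Real.exp (θ * y) - (1 + θ * y) : ℝ) : ℂ) := by
      push_cast; simp
    rw [e, Complex.norm_real, Complex.norm_real, Real.norm_eq_abs, Real.norm_eq_abs,
      sq_abs] at h
    linarith [le_abs_self (Real.exp (θ * y) - (1 + θ * y))]
  have h2 : |θ * y| ≤ |y| / 2 := by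
    rw [abs_mul]; nlinarith [abs_nonneg y]
  have h3 : (|y| / 2) ^ 2 ≤ Real.exp (|y| / 2) := by
    -- With `x = |y|/4` this is the square of `2x ≤ 1 + x + x²/2 ≤ exp x`.
    have h := Real.quadratic_le_exp_of_nonneg (x := |y| / 4) (by positivity)
    have e : Real.exp (|y| / 2) = Real.exp (|y| / 4) ^ 2 := by
      rw [← Real.exp_nat_mul]; congr 1; push_cast; ring
    rw [e]
    refine pow_le_pow_left₀ (by positivity) (le_trans ?_ h) 2
    nlinarith [sq_nonneg (|y| / 4 - 1)]
  have h4 : Real.exp |y| = Real.exp (|y| / 2) * Real.exp (|y| / 2) := by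
    rw [← Real.exp_add]; congr 1; ring
  have h5 : Real.exp |θ * y| ≤ Real.exp (|y| / 2) := Real.exp_le_exp.2 h2
  have h6 : (θ * y) ^ 2 * Real.exp |θ * y| ≤ 4 * θ ^ 2 * Real.exp |y| := by
    have e : (θ * y) ^ 2 = 4 * θ ^ 2 * (|y| / 2) ^ 2 := by
      rw [div_pow, sq_abs]; ring
    rw [e, mul_assoc, h4]
    gcongr
  linarith

lemma integral_exp_mul_le {Y : Ω → ℝ} (hY : Measurable Y)
    (hint : Integrable (fun ω => Real.exp |Y ω|) μ) (h2 : ∫ ω, Real.exp |Y ω| ∂μ ≤ 2)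
    (h0 : ∫ ω, Y ω ∂μ = 0) {θ : ℝ} (hθ : |θ| ≤ 1 / 2) :
    Integrable (fun ω => Real.exp (θ * Y ω)) μ ∧
      ∫ ω, Real.exp (θ * Y ω) ∂μ ≤ Real.exp (8 * θ ^ 2) := by
  have hYi : Integrable Y μ := hint.mono' hY.aestronglyMeasurable
    (Filter.Eventually.of_forall fun ω => by
      rw [Real.norm_eq_abs]; linarith [Real.add_one_le_exp |Y ω|])
  have hi : Integrable (fun ω => Real.exp (θ * Y ω)) μ :=
    hint.mono' (by fun_prop) (Filter.Eventually.of_forall fun ω => by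
      rw [Real.norm_eq_abs, abs_of_pos (Real.exp_pos _)]
      refine Real.exp_le_exp.2 ((le_abs_self _).trans ?_)
      rw [abs_mul]; nlinarith [abs_nonneg (Y ω)])
  refine ⟨hi, ?_⟩
  calc ∫ ω, Real.exp (θ * Y ω) ∂μ
      ≤ ∫ ω, (1 + θ * Y ω + 4 * θ ^ 2 * Real.exp |Y ω|) ∂μ := by
        refine integral_mono hi ?_ fun ω => exp_mul_le_of_abs_le_half hθ
        exact ((integrable_const _).add (hYi.const_mul _)).add (hint.const_mul _)
    _ = 1 + 4 * θ ^ 2 * ∫ ω, Real.exp |Y ω| ∂μ := by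
        have e := integral_add ((integrable_const (1 : ℝ)).add (hYi.const_mul θ))
          (hint.const_mul (4 * θ ^ 2))
        simp only [Pi.add_apply] at e
        rw [e, integral_add (integrable_const _) (hYi.const_mul _), integral_const_mul,
          integral_const_mul, h0]
        simp
    _ ≤ 1 + 8 * θ ^ 2 := by nlinarith [sq_nonneg θ]
    _ ≤ Real.exp (8 * θ ^ 2) := by linarith [Real.add_one_le_exp (8 * θ ^ 2)]

/-- Chernoff bound. The choice `θ = τ/16` minimises `8θ² - θτ`, with value `-τ²/32`; `τ ≤ 8` is what
keeps `θ ≤ 1/2`. -/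
lemma pi_sum_ge_le {n : ℕ} {Y : Ω → ℝ} (hY : Measurable Y)
    (hint : Integrable (fun ω => Real.exp |Y ω|) μ) (h2 : ∫ ω, Real.exp |Y ω| ∂μ ≤ 2)
    (h0 : ∫ ω, Y ω ∂μ = 0) {τ : ℝ} (hτ0 : 0 ≤ τ) (hτ : τ ≤ 8) :
    (Measure.pi (fun _ : Fin n => μ)).real {D | n * τ ≤ ∑ i, Y (D i)}
      ≤ Real.exp (-(n * τ ^ 2 / 32)) := by
  have hθ : |τ / 16| ≤ 1 / 2 := by rw [abs_of_nonneg (by positivity)]; linarith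
  obtain ⟨hi, hb⟩ := integral_exp_mul_le hY hint h2 h0 hθ
  have hexp : ∀ D : Fin n → Ω, Real.exp (τ / 16 * ∑ i, Y (D i))
      = ∏ i, Real.exp (τ / 16 * Y (D i)) := by
    intro D; rw [Finset.mul_sum, Real.exp_sum]
  have hpi : Integrable (fun D : Fin n → Ω => Real.exp (τ / 16 * ∑ i, Y (D i)))
      (Measure.pi (fun _ : Fin n => μ)) := by
    simp only [hexp]
    exact Integrable.fintype_prod (f := fun _ ω => Real.exp (τ / 16 * Y ω)) fun _ => hi
  have := measure_ge_le_exp_mul_mgf (μ := Measure.pi (fun _ : Fin n => μ))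
    (X := fun D => ∑ i, Y (D i)) (n * τ) (t := τ / 16) (by positivity) hpi
  refine this.trans ?_
  rw [mgf]
  simp only [hexp]
  rw [integral_fintype_prod_eq_pow (fun ω => Real.exp (τ / 16 * Y ω)), Fintype.card_fin]
  calc _ ≤ Real.exp (-(τ / 16) * (n * τ)) * Real.exp (8 * (τ / 16) ^ 2) ^ n := by
        gcongr
    _ = _ := by
        rw [← Real.exp_nat_mul, ← Real.exp_add]; congr 1; ring

/-- Two-sided tail bound for an empirical mean. -/
lemma pi_abs_mean_gt_le {n : ℕ} (hn : 0 < n) {Y : Ω → ℝ} (hY : Measurable Y)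
    (hint : Integrable (fun ω => Real.exp |Y ω|) μ) (h2 : ∫ ω, Real.exp |Y ω| ∂μ ≤ 2)
    (h0 : ∫ ω, Y ω ∂μ = 0) {τ : ℝ} (hτ0 : 0 ≤ τ) (hτ : τ ≤ 8) :
    (Measure.pi (fun _ : Fin n => μ)).real {D | τ < |(1 / (n : ℝ)) * ∑ i, Y (D i)|}
      ≤ 2 * Real.exp (-(n * τ ^ 2 / 32)) := by
  have hn' : (0 : ℝ) < n := by exact_mod_cast hn
  have hsub : {D : Fin n → Ω | τ < |(1 / (n : ℝ)) * ∑ i, Y (D i)|}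
      ⊆ {D | n * τ ≤ ∑ i, Y (D i)} ∪ {D | n * τ ≤ ∑ i, (fun ω => -Y ω) (D i)} := by
    intro D hD
    simp only [Set.mem_ofPred_eq, Set.mem_union, Finset.sum_neg_distrib] at hD ⊢
    rw [abs_mul, abs_of_pos (by positivity : (0 : ℝ) < 1 / n), one_div, inv_mul_eq_div,
      lt_div_iff₀ hn'] at hD
    rcases abs_cases (∑ i, Y (D i)) with ⟨h, _⟩ | ⟨h, _⟩
    · left; nlinarith
    · right; nlinarith
  have A := pi_sum_ge_le (n := n) hY hint h2 h0 hτ0 hτ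
  have B := pi_sum_ge_le (n := n) (Y := fun ω => -Y ω) hY.neg (by simpa using hint)
    (by simpa using h2) (by rw [integral_neg, h0, neg_zero]) hτ0 hτ
  calc _ ≤ _ := measureReal_mono hsub
    _ ≤ _ := measureReal_union_le _ _
    _ ≤ _ := by linarith

/-- By `|UV| ≤ (U² + V²)/2`, the exponential moment reduces to those of `U²/4` and `V²/4`, so
neither independence nor joint Gaussianity is needed. The same inequality gives `|m| ≤ 1`, and the
scale 4 is large enough because `exp (1/4) * √2 < 2`. -/
lemma product_gaussian_moments {U V : Ω → ℝ} (hU : Measurable U) (hV : Measurable V)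
    (hU' : μ.map U = gaussianReal 0 1) (hV' : μ.map V = gaussianReal 0 1) {m : ℝ}
    (hm : ∫ ω, U ω * V ω ∂μ = m) :
    Integrable (fun ω => Real.exp |(U ω * V ω - m) / 4|) μ ∧
      ∫ ω, Real.exp |(U ω * V ω - m) / 4| ∂μ ≤ 2 ∧
      ∫ ω, (U ω * V ω - m) / 4 ∂μ = 0 := by
  have sq1 : ∀ {W : Ω → ℝ}, Measurable W → μ.map W = gaussianReal 0 1 →
      Integrable (fun ω => W ω ^ 2) μ ∧ ∫ ω, W ω ^ 2 ∂μ = 1 := by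
    intro W hW hW'
    have hi : Integrable (fun x : ℝ => x ^ 2) (μ.map W) := by
      rw [hW']; exact (memLp_id_gaussianReal 2).integrable_sq
    refine ⟨hi.comp_measurable hW, ?_⟩
    have := variance_fun_id_gaussianReal (μ := 0) (v := 1)
    rw [variance_eq_integral (by fun_prop)] at this
    simp only [integral_id_gaussianReal, sub_zero] at this
    rw [← hW', integral_map hW.aemeasurable (by fun_prop)] at this
    simpa using this
  have ex1 : ∀ {W : Ω → ℝ}, Measurable W → μ.map W = gaussianReal 0 1 →
      Integrable (fun ω => Real.exp (W ω ^ 2 / 4)) μ ∧ ∫ ω, Real.exp (W ω ^ 2 / 4) ∂μ = √2 := by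
    intro W hW hW'
    have := integrable_exp_sq_gaussianReal
    rw [← hW'] at this
    refine ⟨this.1.comp_measurable hW, ?_⟩
    rw [← this.2, integral_map hW.aemeasurable (by fun_prop)]
  obtain ⟨hUi, hU1⟩ := sq1 hU hU'
  obtain ⟨hVi, hV1⟩ := sq1 hV hV'
  obtain ⟨hUe, hU2⟩ := ex1 hU hU'
  obtain ⟨hVe, hV2⟩ := ex1 hV hV'
  have hb : ∀ ω, |U ω * V ω| ≤ (U ω ^ 2 + V ω ^ 2) / 2 := fun ω => by
    rw [abs_le]; constructor <;> nlinarith [sq_nonneg (U ω + V ω), sq_nonneg (U ω - V ω)]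
  have hUV : Integrable (fun ω => U ω * V ω) μ :=
    ((hUi.add hVi).div_const 2).mono' (by fun_prop) (Filter.Eventually.of_forall hb)
  have hm1 : |m| ≤ 1 := by
    rw [← hm]
    refine abs_integral_le_integral_abs.trans ?_
    refine (integral_mono hUV.abs ((hUi.add hVi).div_const 2) hb).trans ?_
    simp only [Pi.add_apply]
    rw [integral_div, integral_add hUi hVi, hU1, hV1]; norm_num
  have hpt : ∀ ω, Real.exp |(U ω * V ω - m) / 4|
      ≤ Real.exp (1 / 4) * ((Real.exp (U ω ^ 2 / 4) + Real.exp (V ω ^ 2 / 4)) / 2) := by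
    intro ω
    have h1 : |(U ω * V ω - m) / 4| ≤ 1 / 4 + (U ω ^ 2 / 8 + V ω ^ 2 / 8) := by
      rw [abs_div, abs_of_pos (by norm_num : (0:ℝ) < 4)]
      have := abs_sub (U ω * V ω) m
      have := hb ω
      linarith
    have h2 : Real.exp (U ω ^ 2 / 8 + V ω ^ 2 / 8)
        ≤ (Real.exp (U ω ^ 2 / 4) + Real.exp (V ω ^ 2 / 4)) / 2 := by
      have e1 : Real.exp (U ω ^ 2 / 4) = Real.exp (U ω ^ 2 / 8) ^ 2 := by
        rw [← Real.exp_nat_mul]; congr 1; push_cast; ring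
      have e2 : Real.exp (V ω ^ 2 / 4) = Real.exp (V ω ^ 2 / 8) ^ 2 := by
        rw [← Real.exp_nat_mul]; congr 1; push_cast; ring
      rw [Real.exp_add, e1, e2]
      nlinarith [sq_nonneg (Real.exp (U ω ^ 2 / 8) - Real.exp (V ω ^ 2 / 8))]
    calc _ ≤ Real.exp (1 / 4 + (U ω ^ 2 / 8 + V ω ^ 2 / 8)) := Real.exp_le_exp.2 h1
      _ = Real.exp (1 / 4) * Real.exp (U ω ^ 2 / 8 + V ω ^ 2 / 8) := Real.exp_add _ _
      _ ≤ _ := by gcongr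
  have hdom := ((hUe.add hVe).div_const 2).const_mul (Real.exp (1 / 4))
  have hint : Integrable (fun ω => Real.exp |(U ω * V ω - m) / 4|) μ :=
    hdom.mono' (by fun_prop) (Filter.Eventually.of_forall fun ω => by
      rw [Real.norm_eq_abs, abs_of_pos (Real.exp_pos _)]; exact hpt ω)
  refine ⟨hint, ?_, ?_⟩
  · refine (integral_mono hint hdom hpt).trans ?_
    simp only [Pi.add_apply]
    rw [integral_const_mul, integral_div, integral_add hUe hVe, hU2, hV2]
    have h1 : Real.exp (1 / 4) ^ 4 < 2.8 := by
      rw [← Real.exp_nat_mul]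
      have e : ((4 : ℕ) : ℝ) * (1 / 4) = 1 := by norm_num
      rw [e]; linarith [Real.exp_one_lt_d9]
    have h2 : Real.exp (1 / 4) ≤ 1.3 := by
      by_contra h
      push Not at h
      have : (1.3 : ℝ) ^ 4 < Real.exp (1 / 4) ^ 4 := by gcongr
      norm_num at this h1
      linarith
    have h3 : √2 ≤ 1.5 := by rw [Real.sqrt_le_left (by norm_num)]; norm_num
    have : 0 ≤ √2 := Real.sqrt_nonneg 2
    nlinarith [Real.exp_pos (1 / 4)]
  · rw [integral_div, integral_sub hUV (integrable_const _), hm]; simp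

end Concentration

/-! ### Empirical means of products of Gaussians of arbitrary variance -/

section ConcentrationProducts

lemma ae_eq_zero_of_map_dirac {Ω : Type*} [MeasurableSpace Ω] {μ : Measure Ω} {U : Ω → ℝ} (hU : Measurable U)
    (h : μ.map U = gaussianReal 0 0) : ∀ᵐ ω ∂μ, U ω = 0 := by
  rw [gaussianReal_zero_var] at h
  have : ∀ᵐ x ∂(μ.map U), x = 0 := by rw [h, ae_dirac_eq]; simp
  exact ae_of_ae_map hU.aemeasurable this

variable {Ω : Type*} [MeasurableSpace Ω] {μ : Measure Ω} [IsProbabilityMeasure μ]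

/-- Covers a factor of zero variance, which cannot be normalised to a standard Gaussian. -/
lemma pi_mean_mul_eq_zero_of_ae_eq_zero {n : ℕ} {U V : Ω → ℝ} (h : ∀ᵐ ω ∂μ, U ω * V ω = 0)
    {m a : ℝ} (ha : 0 ≤ a) (hm : ∫ ω, U ω * V ω ∂μ = m) :
    (Measure.pi (fun _ : Fin n => μ)).real
      {D | a < |(1 / (n : ℝ)) * ∑ i, U (D i) * V (D i) - m|} = 0 := by
  have hm0 : m = 0 := by rw [← hm]; exact integral_eq_zero_of_ae h
  have hall : ∀ᵐ D ∂(Measure.pi (fun _ : Fin n => μ)), ∀ i, U (D i) * V (D i) = 0 := by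
    rw [ae_all_iff]
    intro i
    exact (measurePreserving_eval (fun _ : Fin n => μ) i).quasiMeasurePreserving.ae h
  rw [measureReal_def, ENNReal.toReal_eq_zero_iff]
  left
  refine measure_mono_null ?_ (ae_iff.1 hall)
  intro D hD
  simp only [Set.mem_ofPred_eq] at hD ⊢
  intro h0
  simp only [h0, hm0, Finset.sum_const_zero, mul_zero, sub_zero, abs_zero] at hD
  linarith

/-- Concentration of the empirical mean of a product of two centered Gaussian variables. -/
lemma pi_abs_mean_mul_sub_gt_le {n : ℕ} (hn : 0 < n) {U V : Ω → ℝ} (hU : Measurable U)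
    (hV : Measurable V) {u v : ℝ} (hu : 0 ≤ u) (hv : 0 ≤ v)
    (hU' : μ.map U = gaussianReal 0 (u ^ 2).toNNReal)
    (hV' : μ.map V = gaussianReal 0 (v ^ 2).toNNReal) {m : ℝ}
    (hm : ∫ ω, U ω * V ω ∂μ = m) {L : ℝ} (hL : 0 ≤ L) (hLn : L / n ≤ 1 / 4) :
    (Measure.pi (fun _ : Fin n => μ)).real
      {D | 48 * (u * v) * √(L / n) < |(1 / (n : ℝ)) * ∑ i, U (D i) * V (D i) - m|}
      ≤ 2 * Real.exp (-(4 * L)) := by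
  have hn' : (0 : ℝ) < n := by exact_mod_cast hn
  rcases hu.eq_or_lt with rfl | hu
  · rw [pi_mean_mul_eq_zero_of_ae_eq_zero _ (by positivity) hm]
    · positivity
    · filter_upwards [ae_eq_zero_of_map_dirac hU (by simpa using hU')] with ω h; simp [h]
  rcases hv.eq_or_lt with rfl | hv
  · rw [pi_mean_mul_eq_zero_of_ae_eq_zero _ (by positivity) hm]
    · positivity
    · filter_upwards [ae_eq_zero_of_map_dirac hV (by simpa using hV')] with ω h; simp [h]
  have std : ∀ {W : Ω → ℝ} {a : ℝ}, 0 < a → Measurable W →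
      μ.map W = gaussianReal 0 (a ^ 2).toNNReal →
      μ.map (fun ω => W ω / a) = gaussianReal 0 1 := by
    intro W a ha hW h
    have := gaussianReal_map_div_const (μ := 0) (v := (a ^ 2).toNNReal) a
    rw [← h, Measure.map_map (by fun_prop) hW] at this
    refine this.trans ?_
    rw [zero_div]
    congr 1
    · ext
      rw [NNReal.coe_div, Real.coe_toNNReal _ (sq_nonneg a)]
      simp [ha.ne']
  obtain ⟨h1, h2, h3⟩ := product_gaussian_moments (hU.div_const u) (hV.div_const v)
    (std hu hU hU') (std hv hV hV') (m := m / (u * v)) (by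
      rw [← hm, ← integral_div]; congr 1; ext ω; field_simp)
  have hρ : √(L / n) ≤ 1 / 2 := by
    rw [Real.sqrt_le_left (by norm_num)]; linarith
  have hρ2 : √(L / n) ^ 2 = L / n := Real.sq_sqrt (by positivity)
  have hρ0 := Real.sqrt_nonneg (L / n)
  -- The scale 4 turns `12` into the stated `48`, and the exponent is `12²/32 = 4.5 ≥ 4` times `L`.
  -- The condition `τ ≤ 8` holds because `√(L/n) ≤ 1/2`.
  have := pi_abs_mean_gt_le hn (Y := fun ω => (U ω / u * (V ω / v) - m / (u * v)) / 4)
    (by fun_prop) h1 h2 h3 (τ := 12 * √(L / n)) (by positivity) (by linarith)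
  refine le_trans (measureReal_mono ?_) (this.trans ?_)
  · intro D hD
    simp only [Set.mem_ofPred_eq] at hD ⊢
    have e : (1 / (n : ℝ)) * ∑ i, (U (D i) / u * (V (D i) / v) - m / (u * v)) / 4
        = ((1 / (n : ℝ)) * ∑ i, U (D i) * V (D i) - m) / (4 * (u * v)) := by
      rw [← Finset.sum_div, Finset.sum_sub_distrib, Finset.sum_const, Finset.card_univ,
        Fintype.card_fin, nsmul_eq_mul]
      have : ∑ i, U (D i) / u * (V (D i) / v) = (∑ i, U (D i) * V (D i)) / (u * v) := by
        rw [Finset.sum_div]; exact Finset.sum_congr rfl fun i _ => by field_simp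
      rw [this]
      field_simp
    rw [e, abs_div, abs_of_pos (by positivity : (0 : ℝ) < 4 * (u * v)), lt_div_iff₀ (by positivity)]
    linarith
  · gcongr
    rw [mul_pow, hρ2]
    have : (n : ℝ) * (12 ^ 2 * (L / n)) / 32 = 4.5 * L := by field_simp; ring
    rw [this]; linarith

end ConcentrationProducts

/-! ### Moments of the linear model and the good event -/

section Model

variable {d : ℕ} {Cov : Matrix (Fin d) (Fin d) ℝ} {w : EuclideanSpace ℝ (Fin d)} {σ : ℝ}

lemma measurable_linModel_map (w : EuclideanSpace ℝ (Fin d)) :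
    Measurable (fun p : EuclideanSpace ℝ (Fin d) × ℝ => (p.1, inner ℝ w p.1 + p.2)) := by
  fun_prop

instance isProbabilityMeasure_linModel : IsProbabilityMeasure (linModel Cov w σ) :=
  Measure.isProbabilityMeasure_map (measurable_linModel_map w).aemeasurable

lemma map_linModel {f : EuclideanSpace ℝ (Fin d) × ℝ → ℝ} (hf : Measurable f) :
    (linModel Cov w σ).map f =
      ((multivariateGaussian 0 Cov).prod (gaussianReal 0 (σ ^ 2).toNNReal)).map
        (fun p => f (p.1, inner ℝ w p.1 + p.2)) := by
  rw [linModel, Measure.map_map hf (measurable_linModel_map w)]; rfl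

lemma integral_linModel {f : EuclideanSpace ℝ (Fin d) × ℝ → ℝ} (hf : Measurable f) :
    ∫ p, f p ∂(linModel Cov w σ) = ∫ p, f (p.1, inner ℝ w p.1 + p.2)
      ∂((multivariateGaussian 0 Cov).prod (gaussianReal 0 (σ ^ 2).toNNReal)) := by
  rw [linModel, integral_map (measurable_linModel_map w).aemeasurable hf.aestronglyMeasurable]

lemma map_feature_linModel (hS : Cov.PosSemidef) (j : Fin d) :
    (linModel Cov w σ).map (fun p => p.1 j) = gaussianReal 0 (Cov j j).toNNReal := by
  rw [map_linModel (by fun_prop)]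
  have h := (measurePreserving_eval_multivariateGaussian (μ := 0) hS (i := j)).map_eq
  have : (fun p : EuclideanSpace ℝ (Fin d) × ℝ => p.1 j)
      = (fun x : EuclideanSpace ℝ (Fin d) => x j) ∘ Prod.fst := rfl
  rw [this, ← Measure.map_map (by fun_prop) measurable_fst, Measure.map_fst_prod]
  simp only [measure_univ, one_smul]
  exact h

lemma map_noise_linModel :
    (linModel Cov w σ).map (fun p => p.2 - inner ℝ w p.1)
      = gaussianReal 0 (σ ^ 2).toNNReal := by
  rw [map_linModel (by fun_prop)]
  simp only [add_sub_cancel_left]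
  simp

lemma memLp_feature (j : Fin d) :
    MemLp (fun x : EuclideanSpace ℝ (Fin d) => x j) 2 (multivariateGaussian 0 Cov) := by
  have := (EuclideanSpace.proj (𝕜 := ℝ) j).comp_memLp'
    (IsGaussian.memLp_two_id (μ := multivariateGaussian 0 Cov))
  exact this

lemma integral_feature (j : Fin d) : ∫ x, x j ∂(multivariateGaussian 0 Cov) = 0 := by
  have := (EuclideanSpace.proj (𝕜 := ℝ) j).integral_comp_id_comm
    (IsGaussian.integrable_id (μ := multivariateGaussian 0 Cov))
  simpa using this

lemma integral_feature_mul_feature (hS : Cov.PosSemidef) (j k : Fin d) :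
    ∫ x, x j * x k ∂(multivariateGaussian 0 Cov) = Cov j k := by
  rw [← covariance_eval_multivariateGaussian (μ := 0) hS j k,
    covariance_eq_sub (memLp_feature j) (memLp_feature k), integral_feature]
  simp

lemma integral_linModel_feature_mul_feature (hS : Cov.PosSemidef) (j k : Fin d) :
    ∫ p, p.1 j * p.1 k ∂(linModel Cov w σ) = Cov j k := by
  rw [integral_linModel (by fun_prop)]
  have := integral_fun_fst (μ := multivariateGaussian 0 Cov)
    (ν := gaussianReal 0 (σ ^ 2).toNNReal) (fun x : EuclideanSpace ℝ (Fin d) => x j * x k)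
  rw [this, integral_feature_mul_feature hS]; simp

lemma integral_linModel_feature_mul_noise (j : Fin d) :
    ∫ p, p.1 j * (p.2 - inner ℝ w p.1) ∂(linModel Cov w σ) = 0 := by
  rw [integral_linModel (by fun_prop)]
  simp only [add_sub_cancel_left]
  rw [integral_prod_mul (fun x : EuclideanSpace ℝ (Fin d) => x j) (fun z : ℝ => z),
    integral_feature, zero_mul]

/-- The sample second moments are entrywise close to the population ones. -/
def GoodSample {n : ℕ} (Cov : Matrix (Fin d) (Fin d) ℝ) (w : EuclideanSpace ℝ (Fin d)) (σ ρ : ℝ)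
    (D : Fin n → EuclideanSpace ℝ (Fin d) × ℝ) : Prop :=
  (∀ j k, |(1 / (n : ℝ)) * ∑ i, (D i).1 j * (D i).1 k - Cov j k|
      ≤ 48 * (√(Cov j j) * √(Cov k k)) * ρ) ∧
    ∀ j, |(1 / (n : ℝ)) * ∑ i, (D i).1 j * ((D i).2 - inner ℝ w (D i).1)|
      ≤ 48 * (√(Cov j j) * σ) * ρ

lemma compl_goodSample_le {n : ℕ} (hn : 0 < n) (hS : Cov.PosSemidef) (hσ : 0 ≤ σ)
    {L : ℝ} (hL : 0 ≤ L) (hLn : L / n ≤ 1 / 4) :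
    (Measure.pi (fun _ : Fin n => linModel Cov w σ)).real
      {D | ¬ GoodSample Cov w σ √(L / n) D} ≤ (d ^ 2 + d) * (2 * Real.exp (-(4 * L))) := by
  set ν := Measure.pi (fun _ : Fin n => linModel Cov w σ)
  have hdiag : ∀ j, 0 ≤ Cov j j := fun j => hS.diag_nonneg
  have hsub : {D : Fin n → EuclideanSpace ℝ (Fin d) × ℝ | ¬ GoodSample Cov w σ √(L / n) D}
      ⊆ (⋃ q : Fin d × Fin d, {D | 48 * (√(Cov q.1 q.1) * √(Cov q.2 q.2)) * √(L / n)
            < |(1 / (n : ℝ)) * ∑ i, (D i).1 q.1 * (D i).1 q.2 - Cov q.1 q.2|}) ∪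
        ⋃ j : Fin d, {D | 48 * (√(Cov j j) * σ) * √(L / n)
            < |(1 / (n : ℝ)) * ∑ i, (D i).1 j * ((D i).2 - inner ℝ w (D i).1) - 0|} := by
    intro D hD
    simp only [GoodSample, Set.mem_ofPred_eq, not_and_or, not_forall, not_le] at hD
    simp only [Set.mem_union, Set.mem_iUnion, Set.mem_ofPred_eq, sub_zero]
    rcases hD with ⟨j, k, h⟩ | ⟨j, h⟩
    · exact Or.inl ⟨(j, k), h⟩
    · exact Or.inr ⟨j, h⟩
  have law : ∀ j, (linModel Cov w σ).map (fun p => p.1 j)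
      = gaussianReal 0 (√(Cov j j) ^ 2).toNNReal := fun j => by
    rw [Real.sq_sqrt (hdiag j)]; exact map_feature_linModel hS j
  refine (measureReal_mono hsub).trans ((measureReal_union_le _ _).trans ?_)
  rw [add_mul]
  refine add_le_add ?_ ?_
  · refine (measureReal_iUnion_fintype_le _).trans ?_
    refine (Finset.sum_le_card_nsmul _ _ (2 * Real.exp (-(4 * L))) fun q _ => ?_).trans ?_
    · exact pi_abs_mean_mul_sub_gt_le (μ := linModel Cov w σ) hn
        (U := fun p => p.1 q.1) (V := fun p => p.1 q.2) (by fun_prop) (by fun_prop)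
        (Real.sqrt_nonneg _) (Real.sqrt_nonneg _) (law _) (law _)
        (integral_linModel_feature_mul_feature hS _ _) hL hLn
    · simp [pow_two]
  · refine (measureReal_iUnion_fintype_le _).trans ?_
    refine (Finset.sum_le_card_nsmul _ _ (2 * Real.exp (-(4 * L))) fun j _ => ?_).trans ?_
    · exact pi_abs_mean_mul_sub_gt_le (μ := linModel Cov w σ) hn
        (U := fun p => p.1 j) (V := fun p => p.2 - inner ℝ w p.1) (by fun_prop) (by fun_prop)
        (Real.sqrt_nonneg _) hσ (law _) map_noise_linModel
        (integral_linModel_feature_mul_noise _) hL hLn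
    · simp

/-- The rate `4L` makes each failure probability `2 (δ/d)⁴`, which beats the `d² + d` events: the
total is at most `4 (δ/d)² δ² ≤ δ`. -/
lemma prob_ge_of_goodSample {n : ℕ} (hn : 0 < n) (hd : 0 < d) (hS : Cov.PosSemidef) (hσ : 0 ≤ σ)
    {δ : ℝ} (hδ : 0 < δ) (hδ1 : δ < 1) (hδd : 2 * δ ≤ d) (hLn : Real.log (d / δ) / n ≤ 1 / 4)
    {G : Set (Fin n → EuclideanSpace ℝ (Fin d) × ℝ)}
    (hG : ∀ D, GoodSample Cov w σ √(Real.log (d / δ) / n) D → D ∈ G) :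
    ENNReal.ofReal (1 - δ) ≤ (Measure.pi (fun _ : Fin n => linModel Cov w σ)) G := by
  have hd' : (1 : ℝ) ≤ d := by exact_mod_cast hd
  have hr : (2 : ℝ) ≤ d / δ := by rw [le_div_iff₀ hδ]; exact hδd
  have hL : 0 ≤ Real.log (d / δ) := Real.log_nonneg (by linarith)
  have h := compl_goodSample_le (Cov := Cov) (w := w) hn hS hσ hL hLn
  have hexp : Real.exp (-(4 * Real.log (d / δ))) = (δ / d) ^ 4 := by
    rw [Real.exp_neg, show (4 : ℝ) * Real.log (d / δ) = ((4 : ℕ) : ℝ) * Real.log (d / δ) by norm_num,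
      Real.exp_nat_mul, Real.exp_log (by positivity), ← inv_pow, inv_div]
  have hx : δ / d ≤ 1 / 2 := by rw [div_le_div_iff₀ (by positivity) (by norm_num)]; linarith
  have hx0 : 0 ≤ δ / d := by positivity
  have hfail : (d ^ 2 + d) * (2 * Real.exp (-(4 * Real.log (d / δ)))) ≤ δ := by
    rw [hexp]
    calc ((d : ℝ) ^ 2 + d) * (2 * (δ / d) ^ 4) ≤ (2 * d ^ 2) * (2 * (δ / d) ^ 4) := by
          gcongr; nlinarith
      _ = 4 * (δ / d) ^ 2 * δ ^ 2 := by field_simp; norm_num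
      _ ≤ 4 * (1 / 2) ^ 2 * δ ^ 2 := by gcongr
      _ ≤ δ := by nlinarith
  have hcompl : (Measure.pi (fun _ : Fin n => linModel Cov w σ)) Gᶜ ≤ ENNReal.ofReal δ := by
    rw [← ofReal_measureReal]
    refine ENNReal.ofReal_le_ofReal (le_trans (measureReal_mono ?_) (h.trans hfail))
    intro D hD hgood
    exact hD (hG D hgood)
  -- Subadditivity instead of the complement formula, so that `G` need not be measurable.
  have h1 : (1 : ENNReal) ≤ (Measure.pi (fun _ : Fin n => linModel Cov w σ)) G
      + (Measure.pi (fun _ : Fin n => linModel Cov w σ)) Gᶜ := by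
    rw [← measure_univ (μ := Measure.pi (fun _ : Fin n => linModel Cov w σ)),
      ← Set.union_compl_self G]
    exact measure_union_le _ _
  rw [ENNReal.ofReal_sub _ hδ.le, ENNReal.ofReal_one]
  exact tsub_le_iff_right.2 (h1.trans (by gcongr))

end Model

/-! ### Gradient descent on a noisy quadratic in an inner product space -/

section GradientDescent

variable {E : Type*} [NormedAddCommGroup E] [InnerProductSpace ℝ E]

open scoped RealInnerProductSpace

variable {H : E →ₗ[ℝ] E} {η : ℝ}

/-- Cocoercivity without spectral theory: apply positivity at `x - η • H x` and the upper bound at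
`H x`. -/
lemma norm_sq_apply_le (hsymm : H.IsSymmetric) (hpos : ∀ x, 0 ≤ ⟪H x, x⟫) (hη : 0 < η)
    (hbd : ∀ x, η * ⟪H x, x⟫ ≤ ‖x‖ ^ 2) (x : E) : η * ‖H x‖ ^ 2 ≤ ⟪H x, x⟫ := by
  have h1 := hpos (x - η • H x)
  have h2 := hbd (H x)
  have h3 : ⟪H (x - η • H x), x - η • H x⟫
      = ⟪H x, x⟫ - 2 * η * ‖H x‖ ^ 2 + η ^ 2 * ⟪H (H x), H x⟫ := by
    simp only [map_sub, map_smul, inner_sub_left, inner_sub_right, real_inner_smul_left,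
      real_inner_smul_right, real_inner_self_eq_norm_sq]
    rw [hsymm (H x) x, real_inner_self_eq_norm_sq]
    ring
  nlinarith

lemma norm_sub_smul_apply_le (hsymm : H.IsSymmetric) (hpos : ∀ x, 0 ≤ ⟪H x, x⟫) (hη : 0 < η)
    (hbd : ∀ x, η * ⟪H x, x⟫ ≤ ‖x‖ ^ 2) (x : E) : ‖x - η • H x‖ ≤ ‖x‖ := by
  refine le_of_sq_le_sq ?_ (norm_nonneg _)
  rw [norm_sub_sq_real, norm_smul, real_inner_smul_right, real_inner_comm, Real.norm_eq_abs,
    abs_of_pos hη]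
  have := norm_sq_apply_le hsymm hpos hη hbd x
  have := hpos x
  nlinarith

variable {ξ : E} {e : ℕ → E}

/-- The map `x ↦ x - η • H x` is nonexpansive, so each step adds at most `η * ‖ξ‖`. -/
lemma norm_gd_error_le (hsymm : H.IsSymmetric) (hpos : ∀ x, 0 ≤ ⟪H x, x⟫) (hη : 0 < η)
    (hbd : ∀ x, η * ⟪H x, x⟫ ≤ ‖x‖ ^ 2) (hrec : ∀ t, e (t + 1) = e t - η • (H (e t) - ξ)) (t : ℕ) :
    ‖e t‖ ≤ ‖e 0‖ + η * t * ‖ξ‖ := by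
  induction t with
  | zero => simp
  | succ t ih =>
    have h : e (t + 1) = (e t - η • H (e t)) + η • ξ := by rw [hrec, smul_sub]; abel
    calc ‖e (t + 1)‖ ≤ ‖e t - η • H (e t)‖ + ‖η • ξ‖ := by rw [h]; exact norm_add_le _ _
      _ ≤ ‖e t‖ + η * ‖ξ‖ := by
          rw [norm_smul, Real.norm_eq_abs, abs_of_pos hη]
          gcongr
          exact norm_sub_smul_apply_le hsymm hpos hη hbd _
      _ ≤ _ := by push_cast; linarith

/-- Let `F e = ⟪H e, e⟫ / 2 - ⟪ξ, e⟫`. A step with gradient `g` lowers `F` by at least `(η/2) ‖g‖²`.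
Comparing with `F 0 = 0` by convexity gives `2η F(e_{t+1}) ≤ ‖e_t‖² - ‖e_{t+1}‖²`; this telescopes,
and monotonicity replaces every summand by the last. -/
lemma gd_energy_le (hsymm : H.IsSymmetric) (hpos : ∀ x, 0 ≤ ⟪H x, x⟫) (hη : 0 < η)
    (hbd : ∀ x, η * ⟪H x, x⟫ ≤ ‖x‖ ^ 2) (hrec : ∀ t, e (t + 1) = e t - η • (H (e t) - ξ)) (t : ℕ) :
    2 * η * t * (⟪H (e t), e t⟫ / 2 - ⟪ξ, e t⟫) ≤ ‖e 0‖ ^ 2 - ‖e t‖ ^ 2 := by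
  induction t with
  | zero => simp
  | succ t ih =>
    obtain ⟨g, hg⟩ : ∃ g, g = H (e t) - ξ := ⟨_, rfl⟩
    have hr : e (t + 1) = e t - η • g := by rw [hg, hrec]
    have hgs : η * ⟪H g, g⟫ ≤ ‖g‖ ^ 2 := hbd g
    have hge : ⟪g, e t⟫ = ⟪H (e t), e t⟫ - ⟪ξ, e t⟫ := by rw [hg, inner_sub_left]
    have hgg : ⟪H (e t), g⟫ - ⟪ξ, g⟫ = ‖g‖ ^ 2 := by
      rw [← inner_sub_left, ← hg, real_inner_self_eq_norm_sq]
    have h1 : ⟪H (e (t + 1)), e (t + 1)⟫ / 2 - ⟪ξ, e (t + 1)⟫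
        = (⟪H (e t), e t⟫ / 2 - ⟪ξ, e t⟫) - η * ‖g‖ ^ 2 + η ^ 2 / 2 * ⟪H g, g⟫ := by
      rw [hr]
      simp only [map_sub, map_smul, inner_sub_left, inner_sub_right, real_inner_smul_left,
        real_inner_smul_right]
      rw [hsymm g (e t), real_inner_comm (H (e t)) g, ← hgg]
      ring
    have h2 : ‖e (t + 1)‖ ^ 2 = ‖e t‖ ^ 2 - 2 * η * ⟪g, e t⟫ + η ^ 2 * ‖g‖ ^ 2 := by
      rw [hr, norm_sub_sq_real, norm_smul, real_inner_smul_right, real_inner_comm,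
        Real.norm_eq_abs, abs_of_pos hη]
      ring
    have h3 := hpos (e t)
    have hdesc : ⟪H (e (t + 1)), e (t + 1)⟫ / 2 - ⟪ξ, e (t + 1)⟫
        ≤ (⟪H (e t), e t⟫ / 2 - ⟪ξ, e t⟫) - η / 2 * ‖g‖ ^ 2 := by
      rw [h1]; nlinarith
    have hη2 : 0 ≤ η / 2 * ‖g‖ ^ 2 := by positivity
    have hA : 2 * η * t * (⟪H (e (t + 1)), e (t + 1)⟫ / 2 - ⟪ξ, e (t + 1)⟫)
        ≤ 2 * η * t * (⟪H (e t), e t⟫ / 2 - ⟪ξ, e t⟫) := by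
      exact mul_le_mul_of_nonneg_left (by linarith) (by positivity)
    have hB : 2 * η * (⟪H (e (t + 1)), e (t + 1)⟫ / 2 - ⟪ξ, e (t + 1)⟫)
        ≤ 2 * η * (⟪g, e t⟫ - η / 2 * ‖g‖ ^ 2) := by
      exact mul_le_mul_of_nonneg_left (by linarith) (by positivity)
    push_cast
    nlinarith

/-- The empirical quadratic form of the error of gradient descent after `t` steps. -/
lemma gd_quadratic_le (hsymm : H.IsSymmetric) (hpos : ∀ x, 0 ≤ ⟪H x, x⟫) (hη : 0 < η)
    (hbd : ∀ x, η * ⟪H x, x⟫ ≤ ‖x‖ ^ 2) (hrec : ∀ t, e (t + 1) = e t - η • (H (e t) - ξ))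
    {t : ℕ} (ht : 0 < t) :
    ⟪H (e t), e t⟫ ≤ ‖e 0‖ ^ 2 / (η * t) + 2 * (‖ξ‖ * ‖e t‖) := by
  have h := gd_energy_le hsymm hpos hη hbd hrec t
  have ht' : (0 : ℝ) < t := by exact_mod_cast ht
  have h2 := real_inner_le_norm ξ (e t)
  have h3 : ⟪H (e t), e t⟫ - 2 * ⟪ξ, e t⟫ ≤ ‖e 0‖ ^ 2 / (η * t) := by
    rw [le_div_iff₀ (by positivity)]
    nlinarith [sq_nonneg ‖e t‖]
  linarith

end GradientDescent

/-! ### The training loss and its error recursion -/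

section TrainLoss

variable {n d : ℕ}

/-- The empirical second-moment operator of the features of a data set. -/
noncomputable def empOp (D : Fin n → EuclideanSpace ℝ (Fin d) × ℝ) :
    EuclideanSpace ℝ (Fin d) →ₗ[ℝ] EuclideanSpace ℝ (Fin d) :=
  (1 / (n : ℝ)) • ∑ i, (innerₗ (EuclideanSpace ℝ (Fin d)) (D i).1).smulRight (D i).1

lemma empOp_apply (D : Fin n → EuclideanSpace ℝ (Fin d) × ℝ) (v : EuclideanSpace ℝ (Fin d)) :
    empOp D v = (1 / (n : ℝ)) • ∑ i, (inner ℝ (D i).1 v : ℝ) • (D i).1 := by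
  simp [empOp]

lemma inner_empOp (D : Fin n → EuclideanSpace ℝ (Fin d) × ℝ) (u v : EuclideanSpace ℝ (Fin d)) :
    inner ℝ (empOp D u) v = (1 / (n : ℝ)) * ∑ i, inner ℝ (D i).1 u * inner ℝ (D i).1 v := by
  rw [empOp_apply, real_inner_smul_left, sum_inner]
  simp only [real_inner_smul_left]

lemma isSymmetric_empOp (D : Fin n → EuclideanSpace ℝ (Fin d) × ℝ) : (empOp D).IsSymmetric := by
  intro u v
  rw [inner_empOp, real_inner_comm, inner_empOp]
  congr 1
  exact Finset.sum_congr rfl fun i _ => mul_comm _ _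

lemma inner_empOp_self_nonneg (D : Fin n → EuclideanSpace ℝ (Fin d) × ℝ)
    (v : EuclideanSpace ℝ (Fin d)) : 0 ≤ (inner ℝ (empOp D v) v : ℝ) := by
  rw [inner_empOp]
  exact mul_nonneg (by positivity) (Finset.sum_nonneg fun i _ => mul_self_nonneg _)

/-- The empirical mean of residual times feature at `u`. -/
noncomputable def empResidual (D : Fin n → EuclideanSpace ℝ (Fin d) × ℝ) (u : EuclideanSpace ℝ (Fin d)) :
    EuclideanSpace ℝ (Fin d) :=
  (1 / (n : ℝ)) • ∑ i, ((D i).2 - inner ℝ u (D i).1) • (D i).1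

lemma gradient_trainLoss (D : Fin n → EuclideanSpace ℝ (Fin d) × ℝ)
    (v : EuclideanSpace ℝ (Fin d)) : gradient (trainLoss D) v = -empResidual D v := by
  refine HasGradientAt.gradient ?_
  rw [hasGradientAt_iff_hasFDerivAt]
  have hi : ∀ i : Fin n, HasFDerivAt
      (fun v : EuclideanSpace ℝ (Fin d) => ((D i).2 - inner ℝ v (D i).1) ^ 2)
      ((2 * ((D i).2 - inner ℝ v (D i).1)) • -(innerSL ℝ (D i).1)) v := by
    intro i
    have h1 : HasFDerivAt (fun v : EuclideanSpace ℝ (Fin d) => (inner ℝ v (D i).1 : ℝ))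
        (innerSL ℝ (D i).1) v := by
      have := (innerSL ℝ (D i).1).hasFDerivAt (x := v)
      refine this.congr_of_eventuallyEq (Filter.Eventually.of_forall fun x => ?_)
      simp [real_inner_comm]
    have := (h1.const_sub (D i).2).pow 2
    simpa using this
  have := (HasFDerivAt.fun_sum (u := Finset.univ) fun i _ => hi i).const_mul (1 / (2 * (n : ℝ)))
  refine this.congr_fderiv ?_
  ext u
  simp only [empResidual, InnerProductSpace.toDual_apply_apply, inner_neg_left,
    real_inner_smul_left, sum_inner, smul_apply, sum_apply,
    neg_apply, innerSL_apply_apply, smul_eq_mul, Finset.mul_sum,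
    ← Finset.sum_neg_distrib]
  refine Finset.sum_congr rfl fun i _ => ?_
  rcases Nat.eq_zero_or_pos n with rfl | hn
  · exact i.elim0
  have : (n : ℝ) ≠ 0 := by positivity
  field_simp

lemma empResidual_sub (D : Fin n → EuclideanSpace ℝ (Fin d) × ℝ) (u v : EuclideanSpace ℝ (Fin d)) :
    empResidual D v = empResidual D u - empOp D (v - u) := by
  rw [empResidual, empResidual, empOp_apply, ← smul_sub, ← Finset.sum_sub_distrib]
  congr 1
  refine Finset.sum_congr rfl fun i _ => ?_
  rw [← sub_smul, inner_sub_right, real_inner_comm v, real_inner_comm u]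
  congr 1
  ring

/-- The base point `u` is free: for `u = target` the residual contains only label noise. -/
lemma gd_succ_sub (D : Fin n → EuclideanSpace ℝ (Fin d) × ℝ) (η : ℝ)
    (u : EuclideanSpace ℝ (Fin d)) (t : ℕ) :
    gd D η (t + 1) - u
      = (gd D η t - u) - η • (empOp D (gd D η t - u) - empResidual D u) := by
  rw [gd, gradient_trainLoss, empResidual_sub D u]
  simp only [neg_sub]
  abel

end TrainLoss

/-! ### Population risk for a diagonal covariance -/

section Risk

variable {d : ℕ} {Cov : Matrix (Fin d) (Fin d) ℝ} {w : EuclideanSpace ℝ (Fin d)} {σ : ℝ}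

lemma inner_reweight_diagonal (a : Fin d → ℝ) (x v : EuclideanSpace ℝ (Fin d)) :
    (inner ℝ (reweight (Matrix.diagonal a) x) v : ℝ) = ∑ j, a j * x j * v j := by
  simp only [reweight, PiLp.inner_apply, Matrix.mulVec_diagonal, RCLike.inner_apply, conj_trivial]
  exact Finset.sum_congr rfl fun j _ => by ring

lemma memLp_sum_feature (c : Fin d → ℝ) :
    MemLp (fun x : EuclideanSpace ℝ (Fin d) => ∑ j, c j * x j) 2 (multivariateGaussian 0 Cov) :=
  memLp_finsetSum _ fun j _ => (memLp_feature j).const_mul (c j)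

lemma integral_sum_feature_sq (hS : Cov.PosSemidef) (hdiag : Cov.IsDiag) (c : Fin d → ℝ) :
    ∫ x, (∑ j, c j * x j) ^ 2 ∂(multivariateGaussian 0 Cov) = ∑ j, Cov j j * c j ^ 2 := by
  have hi : ∀ j k, Integrable (fun x : EuclideanSpace ℝ (Fin d) => c j * c k * (x j * x k))
      (multivariateGaussian 0 Cov) := fun j k =>
    ((memLp_feature j).integrable_mul (memLp_feature k)).const_mul _
  have e : ∀ x : EuclideanSpace ℝ (Fin d),
      (∑ j, c j * x j) ^ 2 = ∑ j, ∑ k, c j * c k * (x j * x k) := by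
    intro x
    rw [pow_two, Finset.sum_mul_sum]
    exact Finset.sum_congr rfl fun j _ => Finset.sum_congr rfl fun k _ => by ring
  simp only [e]
  rw [integral_finsetSum _ fun j _ => integrable_finsetSum _ fun k _ => hi j k]
  refine Finset.sum_congr rfl fun j _ => ?_
  rw [integral_finsetSum _ fun k _ => hi j k]
  simp only [integral_const_mul, integral_feature_mul_feature hS]
  rw [Finset.sum_eq_single j]
  · ring
  · intro k _ hk
    rw [hdiag hk.symm, mul_zero]
  · simp

lemma risk_linModel_diagonal (hS : Cov.PosSemidef) (hdiag : Cov.IsDiag) (a : Fin d → ℝ)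
    (v : EuclideanSpace ℝ (Fin d)) :
    risk (linModel Cov w σ) (Matrix.diagonal a) v
      = 1 / 2 * (∑ j, Cov j j * (a j * v j - w j) ^ 2 + σ ^ 2) := by
  set μ := multivariateGaussian 0 Cov
  set ν := gaussianReal 0 (σ ^ 2).toNNReal
  rw [risk]
  congr 1
  simp only [inner_reweight_diagonal]
  rw [integral_linModel (by fun_prop)]
  let g : EuclideanSpace ℝ (Fin d) → ℝ := fun x => ∑ j, (a j * v j - w j) * x j
  have hg : MemLp g 2 μ := memLp_sum_feature fun j => a j * v j - w j
  have hz : MemLp (fun z : ℝ => z) 2 ν := memLp_id_gaussianReal 2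
  have e : ∀ p : EuclideanSpace ℝ (Fin d) × ℝ,
      (∑ j, a j * p.1 j * v j - (inner ℝ w p.1 + p.2)) ^ 2
        = g p.1 ^ 2 - 2 * (g p.1 * p.2) + p.2 ^ 2 := by
    intro p
    have : ∑ j, a j * p.1 j * v j - (inner ℝ w p.1 + p.2) = g p.1 - p.2 := by
      rw [← sub_sub]
      congr 1
      rw [PiLp.inner_apply, ← Finset.sum_sub_distrib]
      exact Finset.sum_congr rfl fun j _ => by
        simp only [RCLike.inner_apply, conj_trivial]; ring
    rw [this]; ring
  simp only [e]
  have h1 : Integrable (fun p : EuclideanSpace ℝ (Fin d) × ℝ => g p.1 ^ 2) (μ.prod ν) :=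
    hg.integrable_sq.comp_fst ν
  have h2 : Integrable (fun p : EuclideanSpace ℝ (Fin d) × ℝ => 2 * (g p.1 * p.2)) (μ.prod ν) :=
    ((hg.integrable one_le_two).mul_prod (hz.integrable one_le_two)).const_mul 2
  have h3 : Integrable (fun p : EuclideanSpace ℝ (Fin d) × ℝ => p.2 ^ 2) (μ.prod ν) :=
    hz.integrable_sq.comp_snd μ
  rw [integral_add (f := fun p : EuclideanSpace ℝ (Fin d) × ℝ => g p.1 ^ 2 - 2 * (g p.1 * p.2))
    (h1.sub h2) h3, integral_sub h1 h2, integral_const_mul,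
    integral_fun_fst (fun x => g x ^ 2), integral_fun_snd (fun z : ℝ => z ^ 2),
    integral_prod_mul g (fun z : ℝ => z)]
  have hz0 : ∫ z, z ∂ν = 0 := integral_id_gaussianReal
  have hz2 : ∫ z, z ^ 2 ∂ν = σ ^ 2 := by
    have := variance_fun_id_gaussianReal (μ := 0) (v := (σ ^ 2).toNNReal)
    rw [variance_eq_integral (by fun_prop)] at this
    simp only [integral_id_gaussianReal, sub_zero] at this
    rw [this, Real.coe_toNNReal _ (sq_nonneg σ)]
  rw [hz0, hz2, integral_sum_feature_sq hS hdiag]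
  simp

/-- The infimum enters only through the lower bound `σ²/2`, the irreducible noise, so no minimiser
has to be found. -/
lemma excessRisk_le (hS : Cov.PosSemidef) (hdiag : Cov.IsDiag) (a : Fin d → ℝ)
    (v : EuclideanSpace ℝ (Fin d)) :
    excessRisk (linModel Cov w σ) (Matrix.diagonal a) v
      ≤ 1 / 2 * ∑ j, Cov j j * (a j * v j - w j) ^ 2 := by
  have h : σ ^ 2 / 2 ≤ ⨅ u, risk (linModel Cov w σ) (Matrix.diagonal a) u := by
    refine le_ciInf fun u => ?_
    rw [risk_linModel_diagonal hS hdiag]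
    have : 0 ≤ ∑ j, Cov j j * (a j * u j - w j) ^ 2 :=
      Finset.sum_nonneg fun j _ => mul_nonneg hS.diag_nonneg (sq_nonneg _)
    linarith
  rw [excessRisk, risk_linModel_diagonal hS hdiag]
  linarith

end Risk

/-! ### Consequences of the good event -/

section Deterministic

variable {n d : ℕ} {Cov : Matrix (Fin d) (Fin d) ℝ} {w : EuclideanSpace ℝ (Fin d)} {σ ρ : ℝ}
  {D : Fin n → EuclideanSpace ℝ (Fin d) × ℝ}

lemma corr_eq_mul (hdiag : Cov.IsDiag) (j : Fin d) : corr Cov w j = w j * Cov j j := by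
  rw [corr, Finset.sum_eq_single j]
  · intro i _ hi; rw [hdiag hi, mul_zero]
  · simp

lemma empCorr_eq (w : EuclideanSpace ℝ (Fin d)) (j : Fin d) :
    empCorr D j = ∑ k, w k * ((1 / (n : ℝ)) * ∑ i, (D i).1 j * (D i).1 k)
      + (1 / (n : ℝ)) * ∑ i, (D i).1 j * ((D i).2 - inner ℝ w (D i).1) := by
  have h : ∀ i, (D i).1 j * (D i).2 = ∑ k, w k * ((D i).1 j * (D i).1 k)
      + (D i).1 j * ((D i).2 - inner ℝ w (D i).1) := by
    intro i
    have : (inner ℝ w (D i).1 : ℝ) = ∑ k, w k * (D i).1 k := by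
      rw [PiLp.inner_apply]
      exact Finset.sum_congr rfl fun k _ => by
        simp only [RCLike.inner_apply, conj_trivial]; ring
    rw [this, mul_sub, Finset.mul_sum]
    have e : ∑ k, w k * ((D i).1 j * (D i).1 k) = ∑ k, (D i).1 j * (w k * (D i).1 k) :=
      Finset.sum_congr rfl fun k _ => by ring
    rw [e]; ring
  rw [empCorr, Finset.sum_congr rfl fun i _ => h i, Finset.sum_add_distrib, mul_add,
    Finset.sum_comm, Finset.mul_sum]
  congr 1
  refine Finset.sum_congr rfl fun k _ => ?_
  rw [← Finset.mul_sum]; ring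

lemma abs_empCorr_sub_corr_le (hS : Cov.PosSemidef) (hD : GoodSample Cov w σ ρ D) (j : Fin d) :
    |empCorr D j - corr Cov w j| ≤ 48 * ρ * √(Cov j j) * (∑ k, |w k| * √(Cov k k) + σ) := by
  have e : empCorr D j - corr Cov w j
      = ∑ k, w k * ((1 / (n : ℝ)) * ∑ i, (D i).1 j * (D i).1 k - Cov j k)
        + (1 / (n : ℝ)) * ∑ i, (D i).1 j * ((D i).2 - inner ℝ w (D i).1) := by
    have hsymm : ∀ k, Cov k j = Cov j k := fun k => by
      have := hS.isHermitian.apply j k; simpa using this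
    rw [empCorr_eq w j, corr]
    simp only [mul_sub, Finset.sum_sub_distrib, hsymm]
    ring
  rw [e]
  refine (abs_add_le _ _).trans ?_
  have h1 : |∑ k, w k * ((1 / (n : ℝ)) * ∑ i, (D i).1 j * (D i).1 k - Cov j k)|
      ≤ ∑ k, |w k| * (48 * (√(Cov j j) * √(Cov k k)) * ρ) := by
    refine (Finset.abs_sum_le_sum_abs _ _).trans (Finset.sum_le_sum fun k _ => ?_)
    rw [abs_mul]
    exact mul_le_mul_of_nonneg_left (hD.1 j k) (abs_nonneg _)
  have h2 := hD.2 j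
  have h3 : ∑ k, |w k| * (48 * (√(Cov j j) * √(Cov k k)) * ρ)
      = 48 * ρ * √(Cov j j) * ∑ k, |w k| * √(Cov k k) := by
    rw [Finset.mul_sum]; exact Finset.sum_congr rfl fun k _ => by ring
  linarith

/-- Cauchy–Schwarz over the support; sparsity enters here. -/
lemma sum_abs_mul_sqrt_le {s : ℕ} (hs : (supp w).card ≤ s) {B : ℝ} (hB : 1 ≤ B)
    (hpos : ∀ j, 0 ≤ Cov j j) (hl : ∀ j, Cov j j ≤ B) (hw : ‖w‖ ≤ B) :
    ∑ k, |w k| * √(Cov k k) ≤ √s * B ^ 2 := by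
  have hsupp : ∑ k, |w k| * √(Cov k k) = ∑ k ∈ supp w, |w k| * √(Cov k k) := by
    refine (Finset.sum_subset (Finset.subset_univ _) fun k _ hk => ?_).symm
    have : w k = 0 := by simpa [supp] using hk
    simp [this]
  have hsq : (∑ k ∈ supp w, |w k| * √(Cov k k)) ^ 2 ≤ (√s * B ^ 2) ^ 2 := by
    calc (∑ k ∈ supp w, |w k| * √(Cov k k)) ^ 2
        ≤ (supp w).card * ∑ k ∈ supp w, (|w k| * √(Cov k k)) ^ 2 := sq_sum_le_card_mul_sum_sq
      _ ≤ s * ∑ k, (w k) ^ 2 * B := by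
          gcongr
          refine (Finset.sum_le_sum_of_subset_of_nonneg (Finset.subset_univ _)
            fun k _ _ => sq_nonneg _).trans (Finset.sum_le_sum fun k _ => ?_)
          rw [mul_pow, sq_abs, Real.sq_sqrt (hpos k)]
          exact mul_le_mul_of_nonneg_left (hl k) (sq_nonneg _)
      _ = s * (‖w‖ ^ 2 * B) := by
          rw [EuclideanSpace.real_norm_sq_eq, Finset.sum_mul]
      _ ≤ s * (B ^ 2 * B ^ 2) := by
          gcongr
          nlinarith
      _ = _ := by rw [mul_pow, Real.sq_sqrt (Nat.cast_nonneg s)]; ring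
  rw [hsupp]
  exact le_of_sq_le_sq hsq (by positivity)

/-- The factor `Cov j j` on the right is essential: it makes spurious weights summable against
`Tr(Σ)` rather than against the dimension. -/
lemma sq_empCorr_sub_corr_le (hS : Cov.PosSemidef) (hD : GoodSample Cov w σ ρ D) {s : ℕ}
    (hs : (supp w).card ≤ s) (hs1 : 1 ≤ s) {B : ℝ} (hB : 1 ≤ B) (hl : ∀ j, Cov j j ≤ B)
    (hw : ‖w‖ ≤ B) (hσ : σ ≤ B) (hρ : 0 ≤ ρ) (j : Fin d) :
    (empCorr D j - corr Cov w j) ^ 2 ≤ (96 * B ^ 2) ^ 2 * s * ρ ^ 2 * Cov j j := by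
  have h := abs_empCorr_sub_corr_le hS hD j
  have h1 := sum_abs_mul_sqrt_le hs hB (fun j => hS.diag_nonneg) hl hw
  have hs1' : 1 ≤ √(s : ℝ) := Real.one_le_sqrt.2 (by exact_mod_cast hs1)
  have h2 : ∑ k, |w k| * √(Cov k k) + σ ≤ 2 * (√s * B ^ 2) := by
    have : σ ≤ √s * B ^ 2 := by nlinarith
    linarith
  have h3 : |empCorr D j - corr Cov w j| ≤ 96 * B ^ 2 * √s * ρ * √(Cov j j) := by
    refine h.trans ?_
    calc _ ≤ 48 * ρ * √(Cov j j) * (2 * (√s * B ^ 2)) := by gcongr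
      _ = _ := by ring
  rw [← sq_abs]
  calc _ ≤ (96 * B ^ 2 * √s * ρ * √(Cov j j)) ^ 2 := by gcongr
    _ = _ := by
      rw [mul_pow, mul_pow, mul_pow, Real.sq_sqrt hS.diag_nonneg,
        Real.sq_sqrt (Nat.cast_nonneg s)]

lemma inner_preprocess (i : Fin n) (v : EuclideanSpace ℝ (Fin d)) :
    (inner ℝ (preprocess D i).1 v : ℝ) = ∑ j, empCorr D j * (D i).1 j * v j :=
  inner_reweight_diagonal _ _ _

lemma preprocess_fst_apply (i : Fin n) (j : Fin d) :
    (preprocess D i).1 j = empCorr D j * (D i).1 j := by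
  simp [preprocess, reweight, empCorrMatrix, Matrix.mulVec_diagonal]

lemma inner_empOp_preprocess (v : EuclideanSpace ℝ (Fin d)) :
    (inner ℝ (empOp (preprocess D) v) v : ℝ)
      = ∑ j, ∑ k, (empCorr D j * v j) * (empCorr D k * v k)
          * ((1 / (n : ℝ)) * ∑ i, (D i).1 j * (D i).1 k) := by
  rw [inner_empOp]
  simp only [inner_preprocess, Finset.sum_mul_sum]
  rw [Finset.sum_comm, Finset.mul_sum]
  refine Finset.sum_congr rfl fun j _ => ?_
  rw [Finset.sum_comm, Finset.mul_sum]
  refine Finset.sum_congr rfl fun k _ => ?_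
  rw [Finset.mul_sum, Finset.mul_sum, Finset.mul_sum]
  exact Finset.sum_congr rfl fun i _ => by ring

/-- The empirical and the population quadratic forms of the preprocessed features are close. -/
lemma abs_inner_empOp_preprocess_sub_le (hS : Cov.PosSemidef) (hdiag : Cov.IsDiag)
    (hD : GoodSample Cov w σ ρ D) (hρ : 0 ≤ ρ) (v : EuclideanSpace ℝ (Fin d)) :
    |(inner ℝ (empOp (preprocess D) v) v : ℝ) - ∑ j, Cov j j * (empCorr D j * v j) ^ 2|
      ≤ 48 * ρ * (∑ j, empCorr D j ^ 2 * Cov j j) * ‖v‖ ^ 2 := by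
  have e : ∑ j, Cov j j * (empCorr D j * v j) ^ 2
      = ∑ j, ∑ k, (empCorr D j * v j) * (empCorr D k * v k) * Cov j k := by
    refine Finset.sum_congr rfl fun j _ => ?_
    rw [Finset.sum_eq_single j]
    · ring
    · intro k _ hk; rw [hdiag hk.symm, mul_zero]
    · simp
  rw [inner_empOp_preprocess, e, ← Finset.sum_sub_distrib]
  simp only [← Finset.sum_sub_distrib, ← mul_sub]
  calc _ ≤ ∑ j, ∑ k, |empCorr D j * v j| * |empCorr D k * v k|
        * (48 * (√(Cov j j) * √(Cov k k)) * ρ) := by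
        refine (Finset.abs_sum_le_sum_abs _ _).trans (Finset.sum_le_sum fun j _ => ?_)
        refine (Finset.abs_sum_le_sum_abs _ _).trans (Finset.sum_le_sum fun k _ => ?_)
        rw [abs_mul, abs_mul]
        exact mul_le_mul_of_nonneg_left (hD.1 j k) (by positivity)
    -- The entrywise error is a rank-one array, so the double sum is a perfect square;
    -- Cauchy–Schwarz then produces the trace of the reweighted covariance.
    _ = 48 * ρ * (∑ j, (|empCorr D j| * √(Cov j j)) * |v j|) ^ 2 := by
        rw [pow_two, Finset.sum_mul_sum, Finset.mul_sum]
        refine Finset.sum_congr rfl fun j _ => ?_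
        rw [Finset.mul_sum]
        refine Finset.sum_congr rfl fun k _ => ?_
        rw [abs_mul, abs_mul]; ring
    _ ≤ 48 * ρ * ((∑ j, (|empCorr D j| * √(Cov j j)) ^ 2) * ∑ j, |v j| ^ 2) := by
        gcongr
        exact Finset.sum_mul_sq_le_sq_mul_sq _ _ _
    _ = _ := by
        rw [EuclideanSpace.real_norm_sq_eq, mul_assoc (48 * ρ)]
        simp only [mul_pow, sq_abs, Real.sq_sqrt hS.diag_nonneg]

/-- The parameter for which the reweighted predictor equals the ground truth. -/
noncomputable def target (D : Fin n → EuclideanSpace ℝ (Fin d) × ℝ)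
    (w : EuclideanSpace ℝ (Fin d)) : EuclideanSpace ℝ (Fin d) :=
  WithLp.toLp 2 fun j => w j / empCorr D j

/-- Off the support the quotient is `0` whatever the empirical correlation, so nonvanishing is
needed only on the support. -/
lemma empCorr_mul_target (h : ∀ j ∈ supp w, empCorr D j ≠ 0) (j : Fin d) :
    empCorr D j * target D w j = w j := by
  by_cases hj : w j = 0
  · simp [target, hj]
  · have := h j (by simpa [supp] using hj)
    simp only [target]
    field_simp

lemma norm_sq_target_le {β : ℝ} (hβ : 0 < β) (h : ∀ j ∈ supp w, β / 2 ≤ |empCorr D j|) {B : ℝ}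
    (hw : ‖w‖ ≤ B) : ‖target D w‖ ^ 2 ≤ (2 * B / β) ^ 2 := by
  have h1 : ‖target D w‖ ^ 2 ≤ (4 / β ^ 2) * ‖w‖ ^ 2 := by
    rw [EuclideanSpace.real_norm_sq_eq, EuclideanSpace.real_norm_sq_eq, Finset.mul_sum]
    refine Finset.sum_le_sum fun j _ => ?_
    simp only [target]
    by_cases hj : w j = 0
    · simp [hj]
    · have hb := h j (by simpa [supp] using hj)
      have hb2 : β ^ 2 / 4 ≤ empCorr D j ^ 2 := by
        rw [← sq_abs (empCorr D j)]; nlinarith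
      have hpos : 0 < empCorr D j ^ 2 := lt_of_lt_of_le (by positivity) hb2
      rw [div_pow, div_le_iff₀ hpos]
      calc w j ^ 2 = 4 / β ^ 2 * w j ^ 2 * (β ^ 2 / 4) := by field_simp
        _ ≤ _ := by gcongr
  refine h1.trans ?_
  have : ‖w‖ ^ 2 ≤ B ^ 2 := by gcongr
  calc 4 / β ^ 2 * ‖w‖ ^ 2 ≤ 4 / β ^ 2 * B ^ 2 := by gcongr
    _ = _ := by ring

/-- At `target` the signal cancels, leaving in coordinate `j` the weight times a feature-noise
correlation. -/
lemma norm_sq_empResidual_target_le (hS : Cov.PosSemidef) (hD : GoodSample Cov w σ ρ D)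
    (h : ∀ j ∈ supp w, empCorr D j ≠ 0) :
    ‖empResidual (preprocess D) (target D w)‖ ^ 2
      ≤ 48 ^ 2 * σ ^ 2 * ρ ^ 2 * ∑ j, empCorr D j ^ 2 * Cov j j := by
  rw [EuclideanSpace.real_norm_sq_eq, Finset.mul_sum]
  refine Finset.sum_le_sum fun j _ => ?_
  have hin : ∀ i, (inner ℝ (target D w) (preprocess D i).1 : ℝ) = inner ℝ w (D i).1 := by
    intro i
    rw [real_inner_comm, inner_preprocess, PiLp.inner_apply]
    refine Finset.sum_congr rfl fun k _ => ?_
    rw [← empCorr_mul_target h k]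
    simp only [RCLike.inner_apply, conj_trivial]; ring
  have e : empResidual (preprocess D) (target D w) j
      = empCorr D j * ((1 / (n : ℝ)) * ∑ i, (D i).1 j * ((D i).2 - inner ℝ w (D i).1)) := by
    have h2 : ∀ i, (preprocess D i).2 = (D i).2 := fun i => rfl
    simp only [empResidual, hin, PiLp.smul_apply, WithLp.ofLp_sum, Finset.sum_apply, smul_eq_mul,
      h2, WithLp.ofLp_smul, Pi.smul_apply, preprocess_fst_apply, Finset.mul_sum]
    exact Finset.sum_congr rfl fun i _ => by ring
  rw [e, mul_pow]
  have h3 := hD.2 j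
  have h4 : ((1 / (n : ℝ)) * ∑ i, (D i).1 j * ((D i).2 - inner ℝ w (D i).1)) ^ 2
      ≤ (48 * (√(Cov j j) * σ) * ρ) ^ 2 := by
    rw [← sq_abs]; gcongr
  calc _ ≤ empCorr D j ^ 2 * (48 * (√(Cov j j) * σ) * ρ) ^ 2 := by gcongr
    _ = _ := by
      rw [mul_pow, mul_pow, mul_pow, Real.sq_sqrt hS.diag_nonneg]; ring

end Deterministic

/-! ### Arithmetic of the sample size and of the stopping time -/

section SampleSize

/-- The consequences of the sample-size condition, written with `ρ = √(log (d/δ) / n)` and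
`τ = Tr(Σ)^(1/3)`. -/
lemma sample_size_bounds {B β τ ρ T : ℝ} {s t : ℝ} (hB : 1 ≤ B) (hβ : 0 < β) (hβB : β ≤ B)
    (hβτ : β ≤ B * τ ^ 3) (hs : 1 ≤ s) (ht : 1 ≤ t) (hτ : 0 < τ) (hT : 0 ≤ T)
    (hTs : T ≤ s * B ^ 3)
    (h : 10 ^ 6 * B ^ 9 * (t ^ 2 * s * (τ ^ 2 + T) * ρ ^ 2) ≤ β ^ 2) :
    ρ ^ 2 ≤ 1 / 4 ∧ 10 ^ 6 * B ^ 9 * (s * τ ^ 2 * ρ ^ 2) ≤ β ^ 2 ∧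
      96 * ρ * T ≤ 1 / (8 * B * t) ∧
      96 * (96 * B ^ 2) ^ 2 * B * s * ρ ^ 3 * τ ^ 3 ≤ 1 / (8 * B * t) := by
  have hB0 : 0 < B := by linarith
  have ht2 : 1 ≤ t ^ 2 := one_le_pow₀ ht
  have hpow : ∀ k : ℕ, 1 ≤ B ^ k := fun k => one_le_pow₀ hB
  have hβ2 : β ^ 2 ≤ B ^ 2 := by gcongr
  have hF1 : 10 ^ 6 * B ^ 9 * (t ^ 2 * s * T * ρ ^ 2) ≤ β ^ 2 := by
    refine le_trans ?_ h
    gcongr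
    nlinarith [sq_nonneg τ]
  have hF2 : 10 ^ 6 * B ^ 9 * (t ^ 2 * s * τ ^ 2 * ρ ^ 2) ≤ β ^ 2 := by
    refine le_trans ?_ h
    gcongr
    linarith
  have hF3 : 10 ^ 6 * B ^ 9 * (s * τ ^ 2 * ρ ^ 2) ≤ β ^ 2 := by
    refine le_trans ?_ hF2
    gcongr
    nlinarith
  -- Allows `τ` to be cancelled from the sample-size condition, leaving a bound on `ρ` alone.
  have hβτ1 : β ≤ B * τ := by
    rcases le_total τ 1 with h1 | h1
    · refine hβτ.trans (mul_le_mul_of_nonneg_left ?_ hB0.le)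
      calc τ ^ 3 ≤ τ ^ 1 := pow_le_pow_of_le_one hτ.le h1 (by norm_num)
        _ = τ := pow_one τ
    · nlinarith
  refine ⟨?_, hF3, ?_, ?_⟩
  · have h1 : 10 ^ 6 * B ^ 9 * (τ ^ 2 * ρ ^ 2) ≤ B ^ 2 * τ ^ 2 := by
      calc 10 ^ 6 * B ^ 9 * (τ ^ 2 * ρ ^ 2) ≤ 10 ^ 6 * B ^ 9 * (s * τ ^ 2 * ρ ^ 2) := by
            gcongr; nlinarith [sq_nonneg τ]
        _ ≤ β ^ 2 := hF3
        _ ≤ (B * τ) ^ 2 := by gcongr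
        _ = B ^ 2 * τ ^ 2 := by ring
    have h2 : 10 ^ 6 * B ^ 7 * ρ ^ 2 ≤ 1 := by
      have : (B ^ 2 * τ ^ 2) * (10 ^ 6 * B ^ 7 * ρ ^ 2) ≤ (B ^ 2 * τ ^ 2) * 1 := by linarith
      exact le_of_mul_le_mul_left this (by positivity)
    nlinarith [hpow 7, sq_nonneg ρ]
  -- One of the two factors `T` is traded for `s * B ^ 3`; the condition is only linear in `T`.
  · have h1 : (ρ * t * T) ^ 2 ≤ (1 / (768 * B)) ^ 2 := by
      calc (ρ * t * T) ^ 2 = (t ^ 2 * T * ρ ^ 2) * T := by ring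
        _ ≤ (t ^ 2 * T * ρ ^ 2) * (s * B ^ 3) := by gcongr
        _ = (t ^ 2 * s * T * ρ ^ 2) * B ^ 3 := by ring
        _ ≤ (B ^ 2 / (10 ^ 6 * B ^ 9)) * B ^ 3 := by
            gcongr
            rw [le_div_iff₀ (by positivity)]
            linarith
        _ = 1 / (10 ^ 6 * B ^ 4) := by field_simp
        _ ≤ (1 / (768 * B)) ^ 2 := by
            rw [div_pow, one_pow]
            apply one_div_le_one_div_of_le (by positivity)
            calc (768 * B) ^ 2 = 589824 * B ^ 2 := by ring
              _ ≤ 10 ^ 6 * B ^ 4 := by gcongr <;> first | exact hB | norm_num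
    have h2 : ρ * t * T ≤ 1 / (768 * B) := le_of_sq_le_sq h1 (by positivity)
    rw [le_div_iff₀ (by positivity)] at h2 ⊢
    linarith
  · have hZ : t ^ 2 * s * (ρ * τ) ^ 2 ≤ 1 / (10 ^ 6 * B ^ 7) := by
      rw [le_div_iff₀ (by positivity)]
      have : B ^ 2 * (t ^ 2 * s * (ρ * τ) ^ 2 * (10 ^ 6 * B ^ 7)) ≤ B ^ 2 * 1 := by
        linarith
      exact le_of_mul_le_mul_left this (by positivity)
    -- The cube of `t² s ρ² τ²` contains `τ⁶ = Tr(Σ)²`; this is what the power `2/3` of the trace is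
    -- for.
    have h1 : (t * s * (ρ * τ) ^ 3) ^ 2 ≤ (1 / (768 * 96 ^ 2 * B ^ 6)) ^ 2 := by
      calc (t * s * (ρ * τ) ^ 3) ^ 2 = (t ^ 2 * s * (ρ * τ) ^ 2) ^ 3 * (1 / (t ^ 4 * s)) := by
            field_simp
        _ ≤ (t ^ 2 * s * (ρ * τ) ^ 2) ^ 3 * 1 := by
            gcongr
            rw [div_le_one (by positivity)]
            nlinarith [one_le_pow₀ ht (n := 4)]
        _ ≤ (1 / (10 ^ 6 * B ^ 7)) ^ 3 * 1 := by gcongr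
        _ = 1 / (10 ^ 18 * B ^ 21) := by field_simp
        _ ≤ (1 / (768 * 96 ^ 2 * B ^ 6)) ^ 2 := by
            rw [div_pow, one_pow]
            apply one_div_le_one_div_of_le (by positivity)
            calc (768 * 96 ^ 2 * B ^ 6) ^ 2 = (768 * 96 ^ 2) ^ 2 * B ^ 12 := by ring
              _ ≤ 10 ^ 18 * B ^ 21 := by gcongr <;> first | exact hB | norm_num
    have h2 : t * s * (ρ * τ) ^ 3 ≤ 1 / (768 * 96 ^ 2 * B ^ 6) :=
      le_of_sq_le_sq h1 (by positivity)
    rw [le_div_iff₀ (by positivity)] at h2 ⊢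
    calc _ = t * s * (ρ * τ) ^ 3 * (768 * 96 ^ 2 * B ^ 6) := by ring
      _ ≤ 1 := h2

/-- Since `ρ² = log (d/δ) / n`, the two terms of `A` arise from the true weights (`T`) and from the
weight errors (`T0`). The constant is `6528² ≥ 48² * 2 * 96²`. -/
lemma noise_le {B σ ρ s T T0 Tt : ℝ} (hB : 1 ≤ B) (hs : 0 ≤ s) (hT : 0 ≤ T) (hT0 : 0 ≤ T0)
    (hTt : Tt ≤ 2 * T + 2 * ((96 * B ^ 2) ^ 2 * s * ρ ^ 2) * B * T0) :
    48 ^ 2 * σ ^ 2 * ρ ^ 2 * Tt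
      ≤ (6528 * B ^ 3) ^ 2 * (σ ^ 2 * T * ρ ^ 2 + σ ^ 2 * s * T0 * ρ ^ 4) := by
  have h1 : 1 ≤ 9216 * B ^ 6 := by linarith [one_le_pow₀ hB (n := 6)]
  have h2 : B ^ 5 ≤ B ^ 6 := pow_le_pow_right₀ hB (by norm_num)
  have hX : 0 ≤ σ ^ 2 * T * ρ ^ 2 := by positivity
  have hY : 0 ≤ σ ^ 2 * s * T0 * ρ ^ 4 := by positivity
  generalize hXe : σ ^ 2 * T * ρ ^ 2 = X at *
  generalize hYe : σ ^ 2 * s * T0 * ρ ^ 4 = Y at *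
  calc 48 ^ 2 * σ ^ 2 * ρ ^ 2 * Tt
      ≤ 48 ^ 2 * σ ^ 2 * ρ ^ 2 * (2 * T + 2 * ((96 * B ^ 2) ^ 2 * s * ρ ^ 2) * B * T0) := by
        gcongr
    _ = 4608 * (1 * X) + 4608 * (9216 * B ^ 5 * Y) := by rw [← hXe, ← hYe]; ring
    _ ≤ 4608 * (9216 * B ^ 6 * X) + 4608 * (9216 * B ^ 6 * Y) := by gcongr
    _ = 42467328 * B ^ 6 * (X + Y) := by ring
    _ ≤ 42614784 * B ^ 6 * (X + Y) := by gcongr; norm_num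
    _ = _ := by ring

/-- Bias-variance trade-off at the prescribed stopping time. -/
lemma tuned_error_le {B β c₁ c₂ η t a q M N x Q P K₁ : ℝ} (hB : 1 ≤ B) (hβ : 0 < β)
    (hc₁ : 0 < c₁) (hη : 0 < η) (hηB : η ≤ B) (ht : 0 < t) (ha : 0 < a)
    (hq : q = η * t) (hlow : c₁ * (1 / β * a⁻¹) ≤ q) (hup : q ≤ c₂ * (1 / β * a⁻¹))
    (hK₁ : 0 ≤ K₁) (hx : x ≤ K₁ * a) (hN0 : 0 ≤ N) {N₀ : ℝ} (hN00 : 0 ≤ N₀)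
    (hN₀ : N₀ ≤ 2 * B / β) (hN : N ≤ N₀ + q * x) (hQ : Q ≤ N₀ ^ 2 / q + 2 * (x * N))
    (hM : M ≤ 1 / (4 * B * t)) (hP : P ≤ Q + M * N ^ 2) :
    P ≤ (4 * B ^ 2 / c₁ + 2 * K₁ * (2 * B + c₂ * K₁) + (2 * B + c₂ * K₁) ^ 2 / (4 * c₁))
      * (a / β) := by
  have hq0 : 0 < q := by rw [hq]; positivity
  have hqa : q * a ≤ c₂ / β := by
    calc q * a ≤ c₂ * (1 / β * a⁻¹) * a := by gcongr
      _ = c₂ / β := by field_simp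
  have hqi : 1 / q ≤ β * a / c₁ := by
    rw [div_le_div_iff₀ hq0 hc₁]
    calc 1 * c₁ = β * a * (c₁ * (1 / β * a⁻¹)) := by field_simp
      _ ≤ β * a * q := by gcongr
  have hNE : N ≤ (2 * B + c₂ * K₁) / β := by
    calc N ≤ N₀ + q * x := hN
      _ ≤ 2 * B / β + q * (K₁ * a) := by gcongr
      _ = 2 * B / β + (q * a) * K₁ := by ring
      _ ≤ 2 * B / β + c₂ / β * K₁ := by gcongr
      _ = _ := by ring
  have hE0 : 0 ≤ (2 * B + c₂ * K₁) / β := hN0.trans hNE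
  have h1 : N₀ ^ 2 / q ≤ 4 * B ^ 2 / c₁ * (a / β) := by
    calc N₀ ^ 2 / q = N₀ ^ 2 * (1 / q) := by ring
      _ ≤ (2 * B / β) ^ 2 * (β * a / c₁) := by gcongr
      _ = _ := by field_simp; norm_num
  have h2 : 2 * (x * N) ≤ 2 * K₁ * (2 * B + c₂ * K₁) * (a / β) := by
    calc 2 * (x * N) ≤ 2 * (K₁ * a * ((2 * B + c₂ * K₁) / β)) := by gcongr
      _ = _ := by ring
  have h3 : M * N ^ 2 ≤ (2 * B + c₂ * K₁) ^ 2 / (4 * c₁) * (a / β) := by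
    -- Uses `η ≤ B`: the `t` of the sample-size condition becomes `q = η t`.
    have hMq : M ≤ 1 / 4 * (1 / q) := by
      refine hM.trans ?_
      rw [hq, ← one_div_mul_one_div_rev, one_div_mul_one_div, ← one_div_mul_one_div]
      rw [one_div_mul_one_div, one_div_mul_one_div]
      apply one_div_le_one_div_of_le (by positivity)
      nlinarith
    calc M * N ^ 2 ≤ 1 / 4 * (β * a / c₁) * N ^ 2 := by gcongr; linarith
      _ ≤ 1 / 4 * (β * a / c₁) * ((2 * B + c₂ * K₁) / β) ^ 2 := by gcongr
      _ = _ := by field_simp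
  linarith

end SampleSize

/-! ### Excess risk on the good event -/

section Main

variable {n d : ℕ} {Cov : Matrix (Fin d) (Fin d) ℝ} {w : EuclideanSpace ℝ (Fin d)} {σ ρ : ℝ}
  {D : Fin n → EuclideanSpace ℝ (Fin d) × ℝ}

lemma sum_sq_empCorr_le (hS : Cov.PosSemidef) {B κ : ℝ} (hκ : 0 ≤ κ)
    (hl : ∀ j, Cov j j ≤ B)
    (hΔ : ∀ j, (empCorr D j - corr Cov w j) ^ 2 ≤ κ * Cov j j) :
    ∑ j, empCorr D j ^ 2 * Cov j j
      ≤ 2 * (∑ j, corr Cov w j ^ 2 * Cov j j) + 2 * κ * B * ∑ j, Cov j j := by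
  rw [Finset.mul_sum, Finset.mul_sum, ← Finset.sum_add_distrib]
  refine Finset.sum_le_sum fun j _ => ?_
  have h0 : 0 ≤ Cov j j := hS.diag_nonneg
  have h1 : empCorr D j ^ 2 ≤ 2 * corr Cov w j ^ 2 + 2 * (κ * Cov j j) := by
    nlinarith [hΔ j, sq_nonneg (empCorr D j - 2 * corr Cov w j)]
  calc empCorr D j ^ 2 * Cov j j
      ≤ (2 * corr Cov w j ^ 2 + 2 * (κ * Cov j j)) * Cov j j := by gcongr
    _ = 2 * (corr Cov w j ^ 2 * Cov j j) + 2 * κ * Cov j j * Cov j j := by ring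
    _ ≤ 2 * (corr Cov w j ^ 2 * Cov j j) + 2 * κ * B * Cov j j := by
        gcongr; exact hl j

lemma sum_sq_corr_le (hS : Cov.PosSemidef) (hdiag : Cov.IsDiag) {B : ℝ}
    (hl : ∀ j, Cov j j ≤ B) (hr : ∀ j, |corr Cov w j| ≤ B) {s : ℕ} (hs : (supp w).card ≤ s)
    (hB : 0 ≤ B) : ∑ j, corr Cov w j ^ 2 * Cov j j ≤ s * B ^ 3 := by
  have h1 : ∑ j, corr Cov w j ^ 2 * Cov j j = ∑ j ∈ supp w, corr Cov w j ^ 2 * Cov j j := by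
    refine (Finset.sum_subset (Finset.subset_univ _) fun k _ hk => ?_).symm
    have : w k = 0 := by simpa [supp] using hk
    simp [corr_eq_mul hdiag, this]
  rw [h1]
  calc _ ≤ ∑ j ∈ supp w, B ^ 3 := by
        refine Finset.sum_le_sum fun j _ => ?_
        have h0 : 0 ≤ Cov j j := hS.diag_nonneg
        rw [← sq_abs]
        calc |corr Cov w j| ^ 2 * Cov j j ≤ B ^ 2 * B := by gcongr; exacts [hr j, hl j]
          _ = B ^ 3 := by ring
    _ = (supp w).card * B ^ 3 := by rw [Finset.sum_const, nsmul_eq_mul]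
    _ ≤ _ := by gcongr

set_option maxHeartbeats 1000000 in
/-- On a good sample, early-stopped gradient descent on the preprocessed data has small excess
risk. -/
lemma excessRisk_le_of_goodSample (hS : Cov.PosSemidef) (hdiag : Cov.IsDiag)
    (hD : GoodSample Cov w σ ρ D) (hρ : 0 ≤ ρ) {s t : ℕ} (hs : (supp w).card ≤ s)
    (hw0 : w ≠ 0) (ht : 2 ≤ t) {B β η τ c₁ c₂ A : ℝ} (hB : 1 ≤ B) (hσ : σ ≤ B)
    (hβ : 0 < β) (hcorr : ∀ i ∈ supp w, β ≤ |corr Cov w i|) (hr : ∀ j, |corr Cov w j| ≤ B)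
    (hl : ∀ j, Cov j j ≤ B) (hw : ‖w‖ ≤ B) (hτ0 : 0 < τ) (hτ : τ ^ 3 = ∑ j, Cov j j)
    (hn : 10 ^ 6 * B ^ 9 * ((t : ℝ) ^ 2 * s * (τ ^ 2 + ∑ j, corr Cov w j ^ 2 * Cov j j) * ρ ^ 2)
      ≤ β ^ 2)
    (hη0 : 0 < η) (hηB : η ≤ B) (hη : ∀ j, η * (corr Cov w j ^ 2 * Cov j j) ≤ 1 / 8)
    (hA0 : 0 < A)
    (hA : A = σ ^ 2 * (∑ j, corr Cov w j ^ 2 * Cov j j) * ρ ^ 2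
      + σ ^ 2 * s * (∑ j, Cov j j) * ρ ^ 4)
    (hc₁ : 0 < c₁) (hlow : c₁ * (1 / β * (√A)⁻¹) ≤ η * t)
    (hup : η * t ≤ c₂ * (1 / β * (√A)⁻¹)) :
    excessRisk (linModel Cov w σ) (empCorrMatrix D) (gd (preprocess D) η t)
      ≤ 1 / 2 * ((4 * B ^ 2 / c₁ + 2 * (6528 * B ^ 3) * (2 * B + c₂ * (6528 * B ^ 3))
        + (2 * B + c₂ * (6528 * B ^ 3)) ^ 2 / (4 * c₁)) * (√A / β)) := by
  set T := ∑ j, corr Cov w j ^ 2 * Cov j j with hTdef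
  set T0 := ∑ j, Cov j j with hT0def
  have hB0 : 0 < B := by linarith
  have hl0 : ∀ j, 0 ≤ Cov j j := fun j => hS.diag_nonneg
  have hT : 0 ≤ T := Finset.sum_nonneg fun j _ => mul_nonneg (sq_nonneg _) (hl0 j)
  have hT0 : 0 ≤ T0 := Finset.sum_nonneg fun j _ => hl0 j
  have hlT0 : ∀ j, Cov j j ≤ T0 := fun j =>
    Finset.single_le_sum (f := fun j => Cov j j) (fun j _ => hl0 j) (Finset.mem_univ j)
  obtain ⟨i, hi⟩ : ∃ i, w i ≠ 0 := by
    by_contra hc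
    push Not at hc
    exact hw0 (by ext i; simpa using hc i)
  have his : i ∈ supp w := by simpa [supp] using hi
  have hs1 : 1 ≤ s := le_trans (Finset.card_pos.2 ⟨i, his⟩) hs
  have hs1' : (1 : ℝ) ≤ s := by exact_mod_cast hs1
  have ht1' : (1 : ℝ) ≤ t := by exact_mod_cast (by omega : 1 ≤ t)
  have ht0 : (0 : ℝ) < t := by linarith
  have hβB : β ≤ B := (hcorr i his).trans (hr i)
  have hβτ : β ≤ B * τ ^ 3 := by
    rw [hτ]
    refine (hcorr i his).trans ?_
    rw [corr_eq_mul hdiag, abs_mul, abs_of_nonneg (hl0 i)]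
    have : |w i| ≤ ‖w‖ := by simpa using PiLp.norm_apply_le w i
    exact mul_le_mul (this.trans hw) (hlT0 i) (hl0 i) hB0.le
  obtain ⟨-, hF, hM1, hM2⟩ := sample_size_bounds hB hβ hβB hβτ hs1' ht1' hτ0 hT
    (sum_sq_corr_le hS hdiag hl hr hs hB0.le) hn
  have hΔ := sq_empCorr_sub_corr_le hS hD hs hs1 hB hl hw hσ hρ
  -- Interpolates between `Cov j j ≤ B` and `Cov j j ≤ Tr(Σ)`, matching the power `2/3` of the
  -- trace.
  have hlτ : ∀ j, Cov j j ≤ B * τ ^ 2 := by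
    intro j
    have h3 : Cov j j ^ 3 ≤ (B * τ ^ 2) ^ 3 := by
      calc Cov j j ^ 3 = Cov j j * Cov j j ^ 2 := by ring
        _ ≤ B * T0 ^ 2 := by gcongr; exacts [hl j, hl0 j, hlT0 j]
        _ ≤ B ^ 3 * T0 ^ 2 := by gcongr; exact le_self_pow₀ hB (by norm_num)
        _ = (B * τ ^ 2) ^ 3 := by rw [← hτ]; ring
    exact le_of_pow_le_pow_left₀ (by norm_num) (by positivity) h3
  -- Used twice: for `|r̂_j| ≥ β/2` on the support, and for step-size stability under the perturbed
  -- weights.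
  have hΔβ : ∀ j, 8 * B ^ 4 * (empCorr D j - corr Cov w j) ^ 2 ≤ β ^ 2 := by
    intro j
    calc 8 * B ^ 4 * (empCorr D j - corr Cov w j) ^ 2
        ≤ 8 * B ^ 4 * ((96 * B ^ 2) ^ 2 * s * ρ ^ 2 * (B * τ ^ 2)) := by
          gcongr
          refine (hΔ j).trans ?_
          gcongr
          exact hlτ j
      _ = 73728 * B ^ 9 * (s * τ ^ 2 * ρ ^ 2) := by ring
      _ ≤ 10 ^ 6 * B ^ 9 * (s * τ ^ 2 * ρ ^ 2) := by gcongr; norm_num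
      _ ≤ β ^ 2 := hF
  have hemp : ∀ j ∈ supp w, β / 2 ≤ |empCorr D j| := by
    intro j hj
    have h1 : |empCorr D j - corr Cov w j| ≤ β / 2 := by
      refine abs_le_of_sq_le_sq ?_ (by positivity)
      have := hΔβ j
      have h8 : 4 * (empCorr D j - corr Cov w j) ^ 2
          ≤ 8 * B ^ 4 * (empCorr D j - corr Cov w j) ^ 2 := by
        gcongr
        nlinarith [one_le_pow₀ hB (n := 4)]
      nlinarith
    have h2 := abs_sub_abs_le_abs_sub (corr Cov w j) (empCorr D j)
    rw [abs_sub_comm] at h2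
    linarith [hcorr j hj]
  have hemp0 : ∀ j ∈ supp w, empCorr D j ≠ 0 := fun j hj h0 => by
    have := hemp j hj
    rw [h0, abs_zero] at this
    linarith
  have hTt := sum_sq_empCorr_le (D := D) (w := w) hS
    (κ := (96 * B ^ 2) ^ 2 * s * ρ ^ 2) (by positivity) hl hΔ
  set Tt := ∑ j, empCorr D j ^ 2 * Cov j j with hTtdef
  have hTt0 : 0 ≤ Tt := Finset.sum_nonneg fun j _ => mul_nonneg (sq_nonneg _) (hl0 j)
  have hM : 48 * ρ * Tt ≤ 1 / (4 * B * t) := by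
    calc 48 * ρ * Tt ≤ 48 * ρ * (2 * T + 2 * ((96 * B ^ 2) ^ 2 * s * ρ ^ 2) * B * T0) := by
          gcongr
      _ = 96 * ρ * T + 96 * (96 * B ^ 2) ^ 2 * B * s * ρ ^ 3 * τ ^ 3 := by rw [hτ]; ring
      _ ≤ 1 / (8 * B * t) + 1 / (8 * B * t) := add_le_add hM1 hM2
      _ = 1 / (4 * B * t) := by field_simp; norm_num
  have hclose := abs_inner_empOp_preprocess_sub_le hS hdiag hD hρ
  have hηj : ∀ j, η * (Cov j j * empCorr D j ^ 2) ≤ 1 / 2 := by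
    intro j
    have h1 : empCorr D j ^ 2
        ≤ 2 * corr Cov w j ^ 2 + 2 * (empCorr D j - corr Cov w j) ^ 2 := by
      nlinarith [sq_nonneg (empCorr D j - 2 * corr Cov w j)]
    have h2 : η * (Cov j j * (empCorr D j - corr Cov w j) ^ 2) ≤ 1 / 8 := by
      calc η * (Cov j j * (empCorr D j - corr Cov w j) ^ 2)
          ≤ B * (B * (empCorr D j - corr Cov w j) ^ 2) := by
            gcongr
            · exact mul_nonneg (hl0 j) (sq_nonneg _)
            · exact hl j
        _ = 8 * B ^ 4 * (empCorr D j - corr Cov w j) ^ 2 / (8 * B ^ 2) := by field_simp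
        _ ≤ B ^ 2 / (8 * B ^ 2) := by
            gcongr
            exact (hΔβ j).trans (by gcongr)
        _ = 1 / 8 := by field_simp
    calc η * (Cov j j * empCorr D j ^ 2) ≤ η * (Cov j j
          * (2 * corr Cov w j ^ 2 + 2 * (empCorr D j - corr Cov w j) ^ 2)) := by
          gcongr; exact hl0 j
      _ = 2 * (η * (corr Cov w j ^ 2 * Cov j j))
          + 2 * (η * (Cov j j * (empCorr D j - corr Cov w j) ^ 2)) := by ring
      _ ≤ 2 * (1 / 8) + 2 * (1 / 8) := by gcongr; exact hη j
      _ = 1 / 2 := by norm_num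
  -- Stability `η H ≤ 1`: half the budget goes to the population form, half to the sampling
  -- deviation.
  have hbd : ∀ v, η * (inner ℝ (empOp (preprocess D) v) v : ℝ) ≤ ‖v‖ ^ 2 := by
    intro v
    have h1 := (abs_le.1 (hclose v)).2
    have h2 : η * ∑ j, Cov j j * (empCorr D j * v j) ^ 2 ≤ 1 / 2 * ‖v‖ ^ 2 := by
      rw [EuclideanSpace.real_norm_sq_eq, Finset.mul_sum, Finset.mul_sum]
      refine Finset.sum_le_sum fun j _ => ?_
      calc η * (Cov j j * (empCorr D j * v j) ^ 2)
          = η * (Cov j j * empCorr D j ^ 2) * v j ^ 2 := by ring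
        _ ≤ _ := by gcongr; exact hηj j
    have h3 : η * (48 * ρ * Tt) ≤ 1 / 2 := by
      calc η * (48 * ρ * Tt) ≤ B * (1 / (4 * B * t)) := by gcongr
        _ = 1 / (4 * t) := by field_simp
        _ ≤ 1 / 2 := by
            apply one_div_le_one_div_of_le (by norm_num); linarith
    calc η * (inner ℝ (empOp (preprocess D) v) v : ℝ)
        ≤ η * (∑ j, Cov j j * (empCorr D j * v j) ^ 2 + 48 * ρ * Tt * ‖v‖ ^ 2) := by
          gcongr; linarith
      _ = η * ∑ j, Cov j j * (empCorr D j * v j) ^ 2 + η * (48 * ρ * Tt) * ‖v‖ ^ 2 := by ring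
      _ ≤ 1 / 2 * ‖v‖ ^ 2 + 1 / 2 * ‖v‖ ^ 2 := by gcongr
      _ = ‖v‖ ^ 2 := by ring
  let e : ℕ → EuclideanSpace ℝ (Fin d) := fun k => gd (preprocess D) η k - target D w
  have hrec : ∀ k, e (k + 1) = e k - η • (empOp (preprocess D) (e k)
      - empResidual (preprocess D) (target D w)) := gd_succ_sub _ η _
  have he0 : ‖e 0‖ = ‖target D w‖ := by simp [e, gd]
  have hnorm := norm_gd_error_le (isSymmetric_empOp _) (inner_empOp_self_nonneg _) hη0 hbd hrec t
  have hquad := gd_quadratic_le (isSymmetric_empOp _) (inner_empOp_self_nonneg _) hη0 hbd hrec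
    (t := t) (by omega)
  have hv : ‖e 0‖ ≤ 2 * B / β := by
    rw [he0]
    exact le_of_sq_le_sq (norm_sq_target_le hβ hemp hw) (by positivity)
  have hξ : ‖empResidual (preprocess D) (target D w)‖ ≤ 6528 * B ^ 3 * √A := by
    refine le_of_sq_le_sq ?_ (by positivity)
    rw [mul_pow (6528 * B ^ 3), Real.sq_sqrt hA0.le, hA]
    exact (norm_sq_empResidual_target_le hS hD hemp0).trans (noise_le hB (Nat.cast_nonneg s) hT hT0 hTt)
  have hpop : ∑ j, Cov j j * (empCorr D j * e t j) ^ 2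
      ≤ (inner ℝ (empOp (preprocess D) (e t)) (e t) : ℝ) + 48 * ρ * Tt * ‖e t‖ ^ 2 := by
    linarith [(abs_le.1 (hclose (e t))).1]
  have hfinal := tuned_error_le hB hβ hc₁ hη0 hηB ht0 (Real.sqrt_pos.2 hA0) rfl hlow hup
    (by positivity) hξ (norm_nonneg (e t)) (norm_nonneg (e 0)) hv hnorm hquad hM
    hpop
  refine (excessRisk_le hS hdiag _ _).trans ?_
  have hsum : ∑ j, Cov j j * (empCorr D j * (gd (preprocess D) η t) j - w j) ^ 2
      = ∑ j, Cov j j * (empCorr D j * e t j) ^ 2 := by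
    refine Finset.sum_congr rfl fun j _ => ?_
    congr 2
    simp only [e, PiLp.sub_apply, mul_sub, empCorr_mul_target hemp0 j]
  rw [hsum]
  gcongr

end Main

/-! ### Operator norms and traces of diagonal matrices -/

section Norms

variable {d : ℕ} {Cov : Matrix (Fin d) (Fin d) ℝ} {w : EuclideanSpace ℝ (Fin d)}

lemma abs_le_norm_diagonal (a : Fin d → ℝ) (j : Fin d) : |a j| ≤ ‖Matrix.diagonal a‖ := by
  rw [Matrix.l2_opNorm_diagonal]
  exact norm_le_pi_norm a j

lemma le_norm_of_isDiag (hdiag : Cov.IsDiag) (j : Fin d) : Cov j j ≤ ‖Cov‖ := by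
  have h := abs_le_norm_diagonal Cov.diag j
  rw [hdiag.diagonal_diag] at h
  exact (le_abs_self _).trans h

lemma corrMatrix_mul_mul (hdiag : Cov.IsDiag) :
    corrMatrix Cov w * Cov * corrMatrix Cov w
      = Matrix.diagonal fun j => corr Cov w j ^ 2 * Cov j j := by
  conv_lhs => rw [← hdiag.diagonal_diag]
  rw [corrMatrix, hdiag.diagonal_diag]
  conv_lhs => enter [1, 2]; rw [← hdiag.diagonal_diag]
  rw [Matrix.diagonal_mul_diagonal, Matrix.diagonal_mul_diagonal]
  congr 1
  ext j
  simp only [Matrix.diag_apply]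
  ring

lemma trace_corrMatrix_mul_mul (hdiag : Cov.IsDiag) :
    (corrMatrix Cov w * Cov * corrMatrix Cov w).trace
      = ∑ j, corr Cov w j ^ 2 * Cov j j := by
  rw [corrMatrix_mul_mul hdiag, Matrix.trace_diagonal]

end Norms

/-- A diagonal covariance in which some relevant feature is correlated with the label. -/
lemma pos_of_corr {d : ℕ} {Cov : Matrix (Fin d) (Fin d) ℝ} {w : EuclideanSpace ℝ (Fin d)} {β : ℝ}
    (hS : Cov.PosSemidef) (hdiag : Cov.IsDiag) (hβ : 0 < β) {i : Fin d}
    (h : β ≤ |corr Cov w i|) : 0 < Cov i i ∧ 0 < corr Cov w i ^ 2 := by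
  have h0 : 0 ≤ Cov i i := hS.diag_nonneg
  have hne : corr Cov w i ≠ 0 := fun h0 => by rw [h0, abs_zero] at h; linarith
  refine ⟨lt_of_le_of_ne h0 fun h1 => hne ?_, by positivity⟩
  rw [corr_eq_mul hdiag, ← h1, mul_zero]

end SparseRegression

theorem theorem1 :
    -- the degree `k` of the polylogarithmic factor and the step-size constant `c` are absolute
    ∃ (k : ℕ) (c : ℝ), 0 < c ∧
    -- `B` bounds everything that is `O(1)`; the sample-size constant `C` depends on `B` only
    ∀ B : ℝ, 0 < B → ∃ C : ℝ, 0 < C ∧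
    -- `c₁`, `c₂`: the constants in the two-sided tuning of `η t`
    ∀ c₁ c₂ : ℝ, 0 < c₁ → c₁ ≤ c₂ → ∃ K : ℝ, 0 < K ∧
    ∀ (d n s t : ℕ) (Cov : Matrix (Fin d) (Fin d) ℝ) (w : EuclideanSpace ℝ (Fin d))
      (σ β δ η : ℝ),
      Cov.IsDiag → Cov.PosSemidef →
      w ≠ 0 → (supp w).card ≤ s →
      0 < σ → σ ≤ B →
      0 < δ → δ < 1 → 2 * δ ≤ d →
      2 ≤ t →
      0 < β → (∀ i ∈ supp w, β ≤ |corr Cov w i|) →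
      ‖corrMatrix Cov w‖ ≤ B → ‖Cov‖ ≤ B → ‖w‖ ≤ B →
      C * (1 / β ^ 2 * (t : ℝ) ^ 2 * s
          * (Cov.trace ^ (2 / 3 : ℝ) + (corrMatrix Cov w * Cov * corrMatrix Cov w).trace)
          * Real.log (d / δ) ^ k) ≤ n →
      η ≤ B → η ≤ c / ‖corrMatrix Cov w * Cov * corrMatrix Cov w‖ →
      c₁ * (1 / β * (noiseLevel Cov w σ δ s n) ^ (-(1 / 2) : ℝ)) ≤ η * t →
      η * t ≤ c₂ * (1 / β * (noiseLevel Cov w σ δ s n) ^ (-(1 / 2) : ℝ)) →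
      ENNReal.ofReal (1 - δ) ≤
        (Measure.pi (fun _ : Fin n => linModel Cov w σ))
          {D | excessRisk (linModel Cov w σ) (empCorrMatrix D) (gd (preprocess D) η t)
                ≤ K * (Real.log t / β * Real.sqrt (noiseLevel Cov w σ δ s n))} := by
  -- One logarithm suffices. The value `1/8` leaves room for doubling when `r` is replaced by `r̂`.
  refine ⟨1, 1 / 8, by norm_num, fun B₀ _ => ?_⟩
  obtain ⟨B, hB, hB₀⟩ : ∃ B : ℝ, 1 ≤ B ∧ B₀ ≤ B := ⟨max 1 B₀, le_max_left _ _, le_max_right _ _⟩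
  have hB0 : 0 < B := by linarith
  refine ⟨10 ^ 6 * B ^ 9, by positivity, fun c₁ c₂ hc₁ hc₂ => ?_⟩
  have hc₂0 : 0 < c₂ := by linarith
  obtain ⟨K, hKdef⟩ : ∃ K : ℝ, K = 4 * B ^ 2 / c₁ + 2 * (6528 * B ^ 3) * (2 * B + c₂ * (6528 * B ^ 3))
        + (2 * B + c₂ * (6528 * B ^ 3)) ^ 2 / (4 * c₁) := ⟨_, rfl⟩
  have hK : 0 < K := by rw [hKdef]; positivity
  refine ⟨K, hK, ?_⟩
  intro d n s t Cov w σ β δ η hdiag hS hw0 hs hσ0 hσ hδ hδ1 hδd ht hβ hcorr hR hCov hw hn hηB hη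
    hlow hup
  obtain ⟨i, hi⟩ : ∃ i, w i ≠ 0 := by
    by_contra hc
    push Not at hc
    exact hw0 (by ext i; simpa using hc i)
  have his : i ∈ supp w := by simpa [supp] using hi
  obtain ⟨hCi, hri⟩ := pos_of_corr hS hdiag hβ (hcorr i his)
  have hd : 0 < d := i.pos
  have hs1 : 1 ≤ s := le_trans (Finset.card_pos.2 ⟨i, his⟩) hs
  have hs1' : (1 : ℝ) ≤ s := by exact_mod_cast hs1
  have ht2' : (2 : ℝ) ≤ t := by exact_mod_cast ht
  have hl0 : ∀ j, 0 ≤ Cov j j := fun j => hS.diag_nonneg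
  have hl : ∀ j, Cov j j ≤ B := fun j => (le_norm_of_isDiag hdiag j).trans (hCov.trans hB₀)
  have hr : ∀ j, |corr Cov w j| ≤ B := fun j =>
    (abs_le_norm_diagonal (corr Cov w) j).trans (hR.trans hB₀)
  have hwB : ‖w‖ ≤ B := hw.trans hB₀
  have hL : 0 < Real.log (d / δ) := Real.log_pos (by rw [lt_div_iff₀ hδ]; linarith)
  set L := Real.log (d / δ) with hLdef
  have hTr : Cov.trace = ∑ j, Cov j j := rfl
  rw [trace_corrMatrix_mul_mul hdiag, hTr, pow_one] at hn
  have hnoise : noiseLevel Cov w σ δ s n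
      = σ ^ 2 * (∑ j, corr Cov w j ^ 2 * Cov j j) * L / n
        + σ ^ 2 * s * (∑ j, Cov j j) * L ^ 2 / (n : ℝ) ^ 2 := by
    rw [noiseLevel, trace_corrMatrix_mul_mul hdiag, hTr]
  have hTi : ∀ j, corr Cov w j ^ 2 * Cov j j ≤ ∑ j, corr Cov w j ^ 2 * Cov j j := fun j =>
    Finset.single_le_sum (f := fun j => corr Cov w j ^ 2 * Cov j j)
      (fun j _ => mul_nonneg (sq_nonneg _) (hl0 j)) (Finset.mem_univ j)
  have hT : 0 < ∑ j, corr Cov w j ^ 2 * Cov j j := (mul_pos hri hCi).trans_le (hTi i)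
  have hT0i : Cov i i ≤ ∑ j, Cov j j :=
    Finset.single_le_sum (f := fun j => Cov j j) (fun j _ => hl0 j) (Finset.mem_univ i)
  have hT0 : 0 < ∑ j, Cov j j := hCi.trans_le hT0i
  obtain ⟨τ, hτdef⟩ : ∃ τ : ℝ, τ = (∑ j, Cov j j) ^ (1 / 3 : ℝ) := ⟨_, rfl⟩
  have hτ0 : 0 < τ := by rw [hτdef]; exact Real.rpow_pos_of_pos hT0 _
  have hτ3 : τ ^ 3 = ∑ j, Cov j j := by
    rw [hτdef, ← Real.rpow_natCast, ← Real.rpow_mul hT0.le]; norm_num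
  have hτ2 : (∑ j, Cov j j) ^ (2 / 3 : ℝ) = τ ^ 2 := by
    rw [hτdef, ← Real.rpow_natCast, ← Real.rpow_mul hT0.le]; norm_num
  rw [hτ2] at hn
  have hn0 : (0 : ℝ) < n := lt_of_lt_of_le (by positivity) hn
  have hn1 : 0 < n := by exact_mod_cast hn0
  have hρ2 : √(L / n) ^ 2 = L / n := Real.sq_sqrt (by positivity)
  have hcond : 10 ^ 6 * B ^ 9 * ((t : ℝ) ^ 2 * s
      * (τ ^ 2 + ∑ j, corr Cov w j ^ 2 * Cov j j) * √(L / n) ^ 2) ≤ β ^ 2 := by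
    rw [hρ2]
    calc _ = 10 ^ 6 * B ^ 9 * (1 / β ^ 2 * (t : ℝ) ^ 2 * s
          * (τ ^ 2 + ∑ j, corr Cov w j ^ 2 * Cov j j) * L) * (β ^ 2 / n) := by field_simp
      _ ≤ n * (β ^ 2 / n) := by gcongr
      _ = β ^ 2 := by field_simp
  have hβB : β ≤ B := (hcorr i his).trans (hr i)
  have hβτ : β ≤ B * τ ^ 3 := by
    rw [hτ3]
    refine (hcorr i his).trans ?_
    rw [corr_eq_mul hdiag, abs_mul, abs_of_pos hCi]
    have : |w i| ≤ ‖w‖ := by simpa using PiLp.norm_apply_le w i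
    exact mul_le_mul (this.trans hwB) hT0i hCi.le hB0.le
  have hLn : L / n ≤ 1 / 4 := by
    rw [← hρ2]
    exact (sample_size_bounds hB hβ hβB hβτ hs1' (by linarith) hτ0 hT.le
      (sum_sq_corr_le hS hdiag hl hr hs hB0.le) hcond).1
  have hA0 : 0 < noiseLevel Cov w σ δ s n := by rw [hnoise]; positivity
  have hA : noiseLevel Cov w σ δ s n = σ ^ 2 * (∑ j, corr Cov w j ^ 2 * Cov j j) * √(L / n) ^ 2
      + σ ^ 2 * s * (∑ j, Cov j j) * √(L / n) ^ 4 := by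
    rw [hnoise, show √(L / n) ^ 4 = (√(L / n) ^ 2) ^ 2 by ring, hρ2]; ring
  have hpow : (noiseLevel Cov w σ δ s n) ^ (-(1 / 2) : ℝ) = (√(noiseLevel Cov w σ δ s n))⁻¹ := by
    rw [Real.rpow_neg hA0.le, Real.sqrt_eq_rpow]
  rw [hpow] at hlow hup
  have ha := Real.sqrt_pos.2 hA0
  -- Positivity of the step size is forced by the lower bound on `η t`.
  have hη0 : 0 < η := by
    have : 0 < η * t := lt_of_lt_of_le (by positivity) hlow
    exact pos_of_mul_pos_left this (Nat.cast_nonneg t)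
  have hηj : ∀ j, η * (corr Cov w j ^ 2 * Cov j j) ≤ 1 / 8 := by
    intro j
    rw [corrMatrix_mul_mul hdiag] at hη
    have hle : ∀ j, corr Cov w j ^ 2 * Cov j j
        ≤ ‖Matrix.diagonal fun j => corr Cov w j ^ 2 * Cov j j‖ := fun j =>
      (le_abs_self _).trans (abs_le_norm_diagonal (fun j => corr Cov w j ^ 2 * Cov j j) j)
    have hpos := (mul_pos hri hCi).trans_le (hle i)
    rw [le_div_iff₀ hpos] at hη
    exact (mul_le_mul_of_nonneg_left (hle j) hη0.le).trans hη
  refine prob_ge_of_goodSample hn1 hd hS hσ0.le hδ hδ1 hδd hLn fun D hD => ?_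
  have hmain := excessRisk_le_of_goodSample hS hdiag hD (Real.sqrt_nonneg _) hs hw0 ht hB
    (hσ.trans hB₀) hβ hcorr hr hl hwB hτ0 hτ3 hcond hη0 (hηB.trans hB₀) hηj hA0 hA hc₁ hlow hup
  rw [← hKdef] at hmain
  -- The bound already holds without the logarithm; `t ≥ 2` lets `log t` absorb the factor `1/2`.
  have hlog : 1 / 2 ≤ Real.log t := by
    have h2 := Real.log_two_gt_d9
    have := Real.log_le_log (by norm_num) ht2'
    linarith
  refine hmain.trans ?_
  calc 1 / 2 * (K * (√(noiseLevel Cov w σ δ s n) / β))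
      ≤ Real.log t * (K * (√(noiseLevel Cov w σ δ s n) / β)) := by gcongr
    _ = _ := by ring
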